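/- Let $f:\mathbb{R}\to\mathbb{R}^n$ be a periodic (possibly constant) $C^3$ function, let $B,K\in\mathbb{R}^{n\times n}$ be (symmetric) positive definite, let $\gamma\ge 0$, and put $q_d(\tau)=(f(\tau),f'(\tau))\in\mathbb{R}^{2n}$. The programmable oscillator is the autonomous system in the state $(x,\varphi)=((s,\dot s),\varphi)\in\mathbb{R}^{2n+1}$ $$\ddot s=f''(\varphi)-B(\dot s-f'(\varphi))-K(s-f(\varphi)),\qquad \dot\varphi=1+\gamma\big((s-f(\varphi))^\top Kf'(\varphi)+(\dot s-f'(\varphi))^\top f''(\varphi)\big).$$ For every $\gamma\ge0$, every initial state has a unique forward solution, and it exists for all $t\ge 0$. Moreover: 1. For every $\gamma\ge 0$ and every initial state, $x(t)$ is bounded on $[0,\infty)$ and $x(t)-q_d(\varphi(t))\to 0$ as $t\to\infty$. 2. Let $\gamma=0$. For every $\varphi_0\in\mathbb{R}$ the trajectory $[q_d(t+\varphi_0),\,t+\varphi_0]$ is a solution, it is globally asymptotically stable among the solutions with $\varphi(0)=\varphi_0$ (for all $\varepsilon>0$, $t_0\ge0$ there is $\delta>0$ such that distance less than $\delta$ at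 time $t_0$ implies distance less than $\varepsilon$ for all $t\ge t_0$; and every such solution converges to it), and it is stable with respect to all solutions. 3. (Globally stable limit cycle.) For every $\gamma\ge0$ and $\varphi_0$, $[q_d(t+\varphi_0),t+\varphi_0]$ is a solution. Its orbit $\mathcal{O}=\{(q_d(\tau),\tau):\tau\in\mathbb{R}\}$ in state space is globally asymptotically orbitally stable, with orbital stability uniform in $\gamma$, hence in particular as $\gamma\to\infty$: for all $\varepsilon>0$, $t_0\ge 0$ there is $\delta>0$ such that for every $\gamma\ge0$ every solution at distance less than $\delta$ from $\mathcal{O}$ at time $t_0$ stays at distance less than $\varepsilon$ from $\mathcal{O}$ for all $t\ge t_0$; and for every $\gamma\ge 0$ the distance of every solution to $\mathcal{O}$ tends to $0$ as $t\to\infty$. In shape space, let $\mathcal{P}=\{q_d(\tau):\tau\in\mathbb{R}\}$. For every $\gamma\ge0$ and every solution, $\mathrm{dist}(x(t),\mathcal{P})\to0$ as $t\to\infty$. If, moreover, $q_d$ is constant, or is regular ($f'$ and $f''$ have no common zero) and without self-intersections ($q_d(a)=q_d(b)$ only if $b-a$ is a period of $f$, possibly $0$ or negative), then $\mathcal{P}$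 is orbitally stable in shape space as $\gamma\to\infty$: there is $\rho>0$ such that for every $\varepsilon>0$ there is $\delta>0$ such that for all sufficiently large $\gamma$, all solutions and all $t_0\ge0$, if $\|x(t_0)-q_d(\varphi(t_0))\|<\rho$ and $\mathrm{dist}(x(t_0),\mathcal{P})<\delta$, then $\mathrm{dist}(x(t),\mathcal{P})<\varepsilon$ for all $t\ge t_0$. -/

import Mathlib

open Set Filter Topology

noncomputable section

/-- Joint space `ℝⁿ` with the Euclidean norm. -/
abbrev Joint (n : ℕ) := EuclideanSpace ℝ (Fin n)

/-- Shape space `ℝ²ⁿ`: pairs `x = (s, ṡ)` with the Euclidean norm. -/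
abbrev Shape (n : ℕ) := WithLp 2 (Joint n × Joint n)

/-- State space `ℝ²ⁿ⁺¹`: states `(x, φ)` with the Euclidean norm. -/
abbrev OscState (n : ℕ) := WithLp 2 (Shape n × ℝ)

/-- The desired trajectory `q_d(τ) = (f(τ), f'(τ))` in shape space. -/
def desired {n : ℕ} (f : ℝ → Joint n) (τ : ℝ) : Shape n :=
  WithLp.toLp 2 (f τ, deriv f τ)

/-- The point `(q_d(τ), τ)` of the state space. -/
def desiredState {n : ℕ} (f : ℝ → Joint n) (τ : ℝ) : OscState n :=
  WithLp.toLp 2 (desired f τ, τ)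

/-- A matrix acting on a vector of joint space. -/
def act {n : ℕ} (A : Matrix (Fin n) (Fin n) ℝ) (u : Joint n) : Joint n :=
  WithLp.toLp 2 (A.mulVec u.ofLp)

/-- Acceleration `f''(φ) - B (v - f'(φ)) - K (s - f(φ))` of the shape dynamic at `((s, v), φ)`. -/
def oscAccel {n : ℕ} (f : ℝ → Joint n) (B K : Matrix (Fin n) (Fin n) ℝ)
    (z : OscState n) : Joint n :=
  deriv (deriv f) z.snd - act B (z.fst.snd - deriv f z.snd) - act K (z.fst.fst - f z.snd)

/-- Phase velocity `1 + γ ((s - f(φ))ᵀ K f'(φ) + (v - f'(φ))ᵀ f''(φ))` at `((s, v), φ)`. -/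
def oscPhaseVel {n : ℕ} (f : ℝ → Joint n) (K : Matrix (Fin n) (Fin n) ℝ) (γ : ℝ)
    (z : OscState n) : ℝ :=
  1 + γ * (inner ℝ (z.fst.fst - f z.snd) (act K (deriv f z.snd))
    + inner ℝ (z.fst.snd - deriv f z.snd) (deriv (deriv f) z.snd))

/-- `z = ((s, v), φ)` solves the programmable oscillator on the time set `I` (one-sided derivative
at an endpoint of an interval `I`): `ṡ = v`, so that `v̇ = s̈` is given by the shape dynamic, and
`φ̇` by the phase dynamic. -/
def IsOscSolutionOn {n : ℕ} (f : ℝ → Joint n) (B K : Matrix (Fin n) (Fin n) ℝ) (γ : ℝ)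
    (I : Set ℝ) (z : ℝ → OscState n) : Prop :=
  ∀ t ∈ I,
    HasDerivWithinAt (fun r => (z r).fst.fst) (z t).fst.snd I t ∧
    HasDerivWithinAt (fun r => (z r).fst.snd) (oscAccel f B K (z t)) I t ∧
    HasDerivWithinAt (fun r => (z r).snd) (oscPhaseVel f K γ (z t)) I t

/-- Solutions for all times `t ≥ 0`. -/
def IsOscSolution {n : ℕ} (f : ℝ → Joint n) (B K : Matrix (Fin n) (Fin n) ℝ) (γ : ℝ)
    (z : ℝ → OscState n) : Prop :=
  IsOscSolutionOn f B K γ (Ici 0) z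

/-- The trajectory `r` is stable with respect to the trajectories of the class `S`. -/
def IsStableTrajectory {X : Type*} [PseudoMetricSpace X] (S : Set (ℝ → X)) (r : ℝ → X) : Prop :=
  ∀ ε > 0, ∀ t₀ ≥ (0 : ℝ), ∃ δ > 0, ∀ z ∈ S,
    dist (z t₀) (r t₀) < δ → ∀ t ≥ t₀, dist (z t) (r t) < ε

/-- The trajectory `r` is globally asymptotically stable with respect to the class `S`: it is
stable, and every trajectory of `S` converges to it. -/
def IsGloballyAS {X : Type*} [PseudoMetricSpace X] (S : Set (ℝ → X)) (r : ℝ → X) : Prop :=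
  IsStableTrajectory S r ∧ ∀ z ∈ S, Tendsto (fun t => dist (z t) (r t)) atTop (𝓝 0)

/-- The orbit `O` is orbitally stable with respect to the trajectories of the class `S`. -/
def IsOrbitallyStable {X : Type*} [PseudoMetricSpace X] (S : Set (ℝ → X)) (O : Set X) : Prop :=
  ∀ ε > 0, ∀ t₀ ≥ (0 : ℝ), ∃ δ > 0, ∀ z ∈ S,
    Metric.infDist (z t₀) O < δ → ∀ t ≥ t₀, Metric.infDist (z t) O < ε

/-- The orbit `O` is globally asymptotically orbitally stable (a globally stable limit cycle)
with respect to the class `S`. -/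
def IsGloballyAOS {X : Type*} [PseudoMetricSpace X] (S : Set (ℝ → X)) (O : Set X) : Prop :=
  IsOrbitallyStable S O ∧
    ∀ z ∈ S, Tendsto (fun t => Metric.infDist (z t) O) atTop (𝓝 0)

/-- The curve `q_d` is a single point, or a regular closed curve without self-intersections:
its velocity `(f', f'')` never vanishes, and two parameters give the same point only if they
differ by a period. -/
def IsPointOrSimpleRegular {n : ℕ} (f : ℝ → Joint n) : Prop :=
  (∀ τ, desired f τ = desired f 0) ∨
    ((∀ τ, ¬ (deriv f τ = 0 ∧ deriv (deriv f) τ = 0)) ∧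
      ∀ a b, desired f a = desired f b → Function.Periodic f (b - a))

end

/-! ### Quadratic forms of positive definite matrices. -/

section Matrices

variable {n : ℕ}

/-! With the errors `p = s - f(φ)`, `q = ṡ - f'(φ)`, the energy `V = (pᵀKp + |q|²)/2` is the
Lyapunov function for every `γ ≥ 0`. The coupling term `g` of the phase dynamic is `-∂V/∂φ`, so the
feedback moves the phase down the gradient of `V`, and `V̇ = -qᵀBq - γg² ≤ 0`
(`hasDerivWithinAt_lyap`). As `V` is comparable to the squared error with constants free of `γ`, the
error never exceeds a fixed multiple of an earlier error, uniformly in `γ`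
(`exists_norm_sub_desired_le`). This gives boundedness and both state space stability claims.

`V̇` has no term in `p` alone. Adding a small multiple of `p · q` gives a strict Lyapunov function
(`strict_lyap_estimate`), so `V` cannot stay above a positive level (`exists_lyap_lt`); by
monotonicity the error tends to zero. Global existence comes from cutting off the vector field: a
solution of the cut-off system is a solution with rescaled time, and the energy argument survives
rescaling.

In shape space the phase may start wrong although `x` is close to the curve. On a simple regular
curve, `g` vanishes close to the target only at the target itself (Rolle and compactness), so `|g|`
is bounded below while `V` is not small. The speed of `x` is bounded independently of `γ`, whereas
`V` falls at rate at least `γg²`: for large `γ` the phase error is removed before `x` can leave the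
neighbourhood of the curve. -/

lemma act_eq_toEuclideanCLM (A : Matrix (Fin n) (Fin n) ℝ) (u : Joint n) :
    act A u = Matrix.toEuclideanCLM (𝕜 := ℝ) A u := rfl

lemma act_zero (A : Matrix (Fin n) (Fin n) ℝ) : act A 0 = 0 := by
  simp [act_eq_toEuclideanCLM]

lemma norm_act_le (A : Matrix (Fin n) (Fin n) ℝ) :
    ∃ C > 0, ∀ u, ‖act A u‖ ≤ C * ‖u‖ := by
  refine ⟨‖Matrix.toEuclideanCLM (𝕜 := ℝ) A‖ + 1, by positivity, fun u => ?_⟩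
  rw [act_eq_toEuclideanCLM]
  refine (ContinuousLinearMap.le_opNorm _ _).trans ?_
  gcongr
  linarith

lemma inner_eq_dotProduct (u v : Joint n) : inner ℝ u v = u.ofLp ⬝ᵥ v.ofLp := by
  rw [EuclideanSpace.inner_eq_star_dotProduct, dotProduct_comm]
  simp

lemma inner_act_comm {A : Matrix (Fin n) (Fin n) ℝ} (hA : A.PosDef) (u v : Joint n) :
    inner ℝ u (act A v) = inner ℝ v (act A u) := by
  have h : A.transpose = A := by
    rw [← Matrix.conjTranspose_eq_transpose_of_trivial]
    exact hA.isHermitian.eq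
  rw [inner_eq_dotProduct, inner_eq_dotProduct]
  simp only [act]
  rw [Matrix.dotProduct_mulVec, dotProduct_comm, ← Matrix.mulVec_transpose, h]

lemma inner_act_self_pos {A : Matrix (Fin n) (Fin n) ℝ} (hA : A.PosDef) {u : Joint n}
    (hu : u ≠ 0) : 0 < inner ℝ u (act A u) := by
  rw [inner_eq_dotProduct]
  have h : u.ofLp ≠ 0 := by
    contrapose! hu
    ext i
    simp [hu]
  simpa [act] using hA.dotProduct_mulVec_pos h

/-- The form attains a positive minimum on the compact unit sphere; homogeneity does the rest. -/
lemma exists_coercive {A : Matrix (Fin n) (Fin n) ℝ} (hA : A.PosDef) :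
    ∃ k > 0, ∀ u : Joint n, k * ‖u‖ ^ 2 ≤ inner ℝ u (act A u) := by
  have hc : Continuous fun u : Joint n => inner ℝ u (act A u) := by
    simp only [act_eq_toEuclideanCLM]
    fun_prop
  obtain ⟨k, hk, h⟩ : ∃ k > 0, ∀ u ∈ Metric.sphere (0 : Joint n) 1, k ≤ inner ℝ u (act A u) := by
    rcases (Metric.sphere (0 : Joint n) 1).eq_empty_or_nonempty with he | hne
    -- The sphere is empty when `n = 0`.
    · exact ⟨1, one_pos, by simp [he]⟩
    · obtain ⟨u, hu, hmin⟩ := (isCompact_sphere (0 : Joint n) 1).exists_isMinOn hne hc.continuousOn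
      refine ⟨_, inner_act_self_pos hA (u := u) ?_, fun v hv => hmin hv⟩
      rintro rfl
      simp at hu
  refine ⟨k, hk, fun u => ?_⟩
  rcases eq_or_ne u 0 with rfl | hu
  · simp
  have hn : ‖u‖ ≠ 0 := norm_ne_zero_iff.2 hu
  have := h (‖u‖⁻¹ • u) (by simp [norm_smul, hn])
  rw [act_eq_toEuclideanCLM, map_smul, inner_smul_left, inner_smul_right] at this
  simp only [← act_eq_toEuclideanCLM, conj_trivial] at this
  calc k * ‖u‖ ^ 2 ≤ (‖u‖⁻¹ * (‖u‖⁻¹ * inner ℝ u (act A u))) * ‖u‖ ^ 2 := by gcongr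
    _ = _ := by field_simp

end Matrices

/-! ### Error dynamics and the energy identity. -/

section Lyapunov

variable {n : ℕ}

/-- Position error `s - f(φ)`. -/
noncomputable def posErr (f : ℝ → Joint n) (z : OscState n) : Joint n := z.fst.fst - f z.snd

/-- Velocity error `v - f'(φ)`. -/
noncomputable def velErr (f : ℝ → Joint n) (z : OscState n) : Joint n := z.fst.snd - deriv f z.snd

/-- The coupling term of the phase dynamic, minus the phase derivative of `lyap`. -/
noncomputable def coupling (f : ℝ → Joint n) (K : Matrix (Fin n) (Fin n) ℝ) (z : OscState n) : ℝ :=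
  inner ℝ (posErr f z) (act K (deriv f z.snd)) + inner ℝ (velErr f z) (deriv (deriv f) z.snd)

/-- The energy of the error. -/
noncomputable def lyap (f : ℝ → Joint n) (K : Matrix (Fin n) (Fin n) ℝ) (z : OscState n) : ℝ :=
  (inner ℝ (posErr f z) (act K (posErr f z)) + inner ℝ (velErr f z) (velErr f z)) / 2

lemma differentiable_deriv_of_contDiff {f : ℝ → Joint n} (hf : ContDiff ℝ 3 f) :
    Differentiable ℝ f ∧ Differentiable ℝ (deriv f) ∧ ContDiff ℝ 1 (deriv (deriv f)) := by
  have h1 : ContDiff ℝ (2 + 1) f := hf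
  have h2 : ContDiff ℝ (1 + 1) (deriv f) := (contDiff_succ_iff_deriv.1 h1).2.2
  exact ⟨(contDiff_succ_iff_deriv.1 h1).1, (contDiff_succ_iff_deriv.1 h2).1,
    (contDiff_succ_iff_deriv.1 h2).2.2⟩

variable {f : ℝ → Joint n} {B K : Matrix (Fin n) (Fin n) ℝ} {γ θ t : ℝ} {I : Set ℝ}
  {z : ℝ → OscState n}

/-- The factor `θ` is a time rescaling, needed for the cut-off system in the existence proof; `θ =
1` is the oscillator. -/
lemma hasDerivWithinAt_posErr (hf : ContDiff ℝ 3 f)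
    (h₁ : HasDerivWithinAt (fun r => (z r).fst.fst) (θ • (z t).fst.snd) I t)
    (h₃ : HasDerivWithinAt (fun r => (z r).snd) (θ * oscPhaseVel f K γ (z t)) I t) :
    HasDerivWithinAt (fun r => posErr f (z r))
      (θ • (velErr f (z t) - (γ * coupling f K (z t)) • deriv f (z t).snd)) I t := by
  have := h₁.sub ((((differentiable_deriv_of_contDiff hf).1 _).hasDerivAt).scomp_hasDerivWithinAt
    t h₃)
  refine this.congr_deriv ?_
  simp only [oscPhaseVel, velErr, coupling, posErr]
  module

lemma hasDerivWithinAt_velErr (hf : ContDiff ℝ 3 f)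
    (h₂ : HasDerivWithinAt (fun r => (z r).fst.snd) (θ • oscAccel f B K (z t)) I t)
    (h₃ : HasDerivWithinAt (fun r => (z r).snd) (θ * oscPhaseVel f K γ (z t)) I t) :
    HasDerivWithinAt (fun r => velErr f (z r))
      (θ • (-act B (velErr f (z t)) - act K (posErr f (z t))
        - (γ * coupling f K (z t)) • deriv (deriv f) (z t).snd)) I t := by
  have := h₂.sub ((((differentiable_deriv_of_contDiff hf).2.1 _).hasDerivAt).scomp_hasDerivWithinAt
    t h₃)
  refine this.congr_deriv ?_
  simp only [oscPhaseVel, oscAccel, velErr, coupling, posErr]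
  module

/-- The terms `qᵀKp` cancel by symmetry of `K`, the damping leaves `-qᵀBq`, and the phase feedback
contributes `γg · ∂V/∂φ = -γg²`. -/
lemma hasDerivWithinAt_lyap (hf : ContDiff ℝ 3 f) (hK : K.PosDef)
    (h₁ : HasDerivWithinAt (fun r => (z r).fst.fst) (θ • (z t).fst.snd) I t)
    (h₂ : HasDerivWithinAt (fun r => (z r).fst.snd) (θ • oscAccel f B K (z t)) I t)
    (h₃ : HasDerivWithinAt (fun r => (z r).snd) (θ * oscPhaseVel f K γ (z t)) I t) :
    HasDerivWithinAt (fun r => lyap f K (z r))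
      (θ * (-inner ℝ (velErr f (z t)) (act B (velErr f (z t))) - γ * coupling f K (z t) ^ 2))
      I t := by
  have hp := hasDerivWithinAt_posErr hf h₁ h₃
  have hq := hasDerivWithinAt_velErr hf h₂ h₃
  have hKp := (Matrix.toEuclideanCLM (𝕜 := ℝ) K).hasFDerivAt.comp_hasDerivWithinAt t hp
  have := ((hp.inner ℝ hKp).add (hq.inner ℝ hq)).div_const 2
  refine this.congr_deriv ?_
  simp only [Function.comp_apply, ← act_eq_toEuclideanCLM]
  rw [inner_act_comm hK (posErr f (z t)), real_inner_comm (velErr f (z t)) (_ • _)]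
  simp only [inner_smul_left, inner_smul_right, inner_sub_left, inner_sub_right, inner_neg_right,
    conj_trivial]
  have e : coupling f K (z t) = inner ℝ (deriv f (z t).snd) (act K (posErr f (z t)))
      + inner ℝ (velErr f (z t)) (deriv (deriv f) (z t).snd) := by
    rw [coupling, inner_act_comm hK]
  rw [real_inner_comm (deriv (deriv f) (z t).snd),
    real_inner_comm (act K (posErr f (z t))) (velErr f (z t))] at *
  linear_combination (θ * γ * coupling f K (z t)) * e

/-- The cross term supplies `-pᵀKp`, the dissipation in the position error that the energy alone
does not provide. -/
lemma hasDerivWithinAt_inner_posErr_velErr (hf : ContDiff ℝ 3 f)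
    (h₁ : HasDerivWithinAt (fun r => (z r).fst.fst) ((z t).fst.snd) I t)
    (h₂ : HasDerivWithinAt (fun r => (z r).fst.snd) (oscAccel f B K (z t)) I t)
    (h₃ : HasDerivWithinAt (fun r => (z r).snd) (oscPhaseVel f K γ (z t)) I t) :
    HasDerivWithinAt (fun r => inner ℝ (posErr f (z r)) (velErr f (z r)))
      (inner ℝ (velErr f (z t)) (velErr f (z t))
        - inner ℝ (posErr f (z t)) (act K (posErr f (z t)))
        - inner ℝ (posErr f (z t)) (act B (velErr f (z t)))
        - γ * coupling f K (z t) * (inner ℝ (deriv f (z t).snd) (velErr f (z t))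
          + inner ℝ (posErr f (z t)) (deriv (deriv f) (z t).snd))) I t := by
  have hp := hasDerivWithinAt_posErr (θ := 1) hf (by simpa using h₁) (by simpa using h₃)
  have hq := hasDerivWithinAt_velErr (θ := 1) hf (by simpa using h₂) (by simpa using h₃)
  refine (hp.inner ℝ hq).congr_deriv ?_
  simp only [one_smul, inner_smul_left, inner_smul_right, inner_sub_left, inner_sub_right,
    inner_neg_right, conj_trivial]
  ring

end Lyapunov

/-! ### Global existence and uniqueness for `C¹` vector fields. -/

section ODE

lemma image_sub_le_of_hasDerivWithinAt_le {u u' : ℝ → ℝ} {a b C : ℝ} (hab : a ≤ b)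
    (h : ∀ t ∈ Icc a b, HasDerivWithinAt u (u' t) (Icc a b) t)
    (hC : ∀ t ∈ Icc a b, u' t ≤ C) : u b ≤ u a + C * (b - a) := by
  refine image_le_of_deriv_right_le_deriv_boundary (f := u) (f' := u') (a := a) (b := b)
    (B := fun t => u a + C * (t - a)) (B' := fun _ => C)
    (fun t ht => (h t ht).continuousWithinAt) (fun t ht => ?_) (by simp) (by fun_prop)
    (fun t _ => ?_) (fun t ht => hC t (Ico_subset_Icc_self ht)) (right_mem_Icc.2 hab)
  · exact (h t (Ico_subset_Icc_self ht)).mono_of_mem_nhdsWithin (Icc_mem_nhdsGE_of_mem ht)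
  · simpa using ((((hasDerivAt_id t).sub_const a).const_mul C).const_add (u a)).hasDerivWithinAt

variable {E : Type*} [NormedAddCommGroup E] [NormedSpace ℝ E]

lemma exists_solution_of_contDiff_of_hasCompactSupport [CompleteSpace E] {F : E → E}
    (hF : ContDiff ℝ 1 F) (hc : HasCompactSupport F) (z₀ : E) {T : ℝ} (hT : 0 ≤ T) :
    ∃ z : ℝ → E, z 0 = z₀ ∧ ∀ t ∈ Icc 0 T, HasDerivWithinAt z (F (z t)) (Icc 0 T) t := by
  obtain ⟨k, hk⟩ := hF.lipschitzWith_of_hasCompactSupport hc one_ne_zero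
  obtain ⟨C, hC⟩ := hc.exists_bound_of_continuous hF.continuous
  have hC0 : 0 ≤ C := (norm_nonneg _).trans (hC 0)
  lift C to NNReal using hC0
  lift T to NNReal using hT
  -- The field is bounded by `C`, so within time `T` no curve leaves the ball of radius `C * T`:
  -- Picard–Lindelöf applies to the whole interval at once.
  have hpl : IsPicardLindelof (fun _ => F) (tmin := 0) (tmax := T) ⟨0, by simp⟩ z₀
      (C * T) 0 C k :=
    { lipschitzOnWith := fun _ _ => hk.lipschitzOnWith
      continuousOn := fun _ _ => continuousOn_const
      norm_le := fun _ _ x _ => hC x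
      mul_max_le := by simp }
  exact hpl.exists_eq_forall_mem_Icc_hasDerivWithinAt₀

/-- Both curves stay in one compact ball, where a `C¹` field is Lipschitz. -/
lemma eqOn_of_hasDerivWithinAt_of_contDiff [FiniteDimensional ℝ E] {F : E → E}
    (hF : ContDiff ℝ 1 F) {z w : ℝ → E} {T : ℝ}
    (hz : ∀ t ∈ Icc 0 T, HasDerivWithinAt z (F (z t)) (Icc 0 T) t)
    (hw : ∀ t ∈ Icc 0 T, HasDerivWithinAt w (F (w t)) (Icc 0 T) t) (h0 : z 0 = w 0) :
    EqOn z w (Icc 0 T) := by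
  have hzc : ContinuousOn z (Icc 0 T) := fun t ht => (hz t ht).continuousWithinAt
  have hwc : ContinuousOn w (Icc 0 T) := fun t ht => (hw t ht).continuousWithinAt
  obtain ⟨R, hR⟩ := ((isCompact_Icc.image_of_continuousOn hzc).isBounded.union
    (isCompact_Icc.image_of_continuousOn hwc).isBounded).subset_closedBall 0
  obtain ⟨k, hk⟩ := hF.contDiffOn.exists_lipschitzOnWith one_ne_zero
    (convex_closedBall (0 : E) R) (isCompact_closedBall 0 R)
  exact ODE_solution_unique_of_mem_Icc_right (v := fun _ => F)
    (s := fun _ => Metric.closedBall 0 R) (fun _ _ => hk) hzc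
    (fun t ht => (hz t (Ico_subset_Icc_self ht)).mono_of_mem_nhdsWithin (Icc_mem_nhdsGE_of_mem ht))
    (fun t ht => hR (Or.inl ⟨t, Ico_subset_Icc_self ht, rfl⟩)) hwc
    (fun t ht => (hw t (Ico_subset_Icc_self ht)).mono_of_mem_nhdsWithin (Icc_mem_nhdsGE_of_mem ht))
    (fun t ht => hR (Or.inr ⟨t, Ico_subset_Icc_self ht, rfl⟩)) h0

lemma exists_solution_Ici_of_forall_exists_solution_Icc [FiniteDimensional ℝ E] {F : E → E}
    (hF : ContDiff ℝ 1 F) {z₀ : E}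
    (h : ∀ T > 0, ∃ z : ℝ → E, z 0 = z₀ ∧
      ∀ t ∈ Icc 0 T, HasDerivWithinAt z (F (z t)) (Icc 0 T) t) :
    ∃ z : ℝ → E, z 0 = z₀ ∧ ∀ t ∈ Ici 0, HasDerivWithinAt z (F (z t)) (Ici 0) t := by
  -- `Z N` lives on `[0, N + 1]`, so `t < ⌊t⌋₊ + 1` leaves room to the right of `t` for
  -- differentiating the glued curve `t ↦ Z ⌊t⌋₊ t`.
  choose Z hZ0 hZ using fun N : ℕ => h (N + 1) (by positivity)
  have hZe : ∀ M N : ℕ, M ≤ N → EqOn (Z M) (Z N) (Icc 0 (M + 1)) := fun M N hMN => by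
    have hs : Icc (0 : ℝ) (M + 1) ⊆ Icc 0 (N + 1) := Icc_subset_Icc_right (by gcongr)
    exact eqOn_of_hasDerivWithinAt_of_contDiff hF (hZ M)
      (fun t ht => (hZ N t (hs ht)).mono hs) (by rw [hZ0, hZ0])
  have hz : ∀ N : ℕ, ∀ r ∈ Ico (0 : ℝ) (N + 1), Z ⌊r⌋₊ r = Z N r := fun N r hr => by
    refine hZe _ _ ?_ ⟨hr.1, (Nat.lt_floor_add_one r).le⟩
    rw [← Nat.lt_add_one_iff, Nat.floor_lt hr.1]
    exact_mod_cast hr.2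
  refine ⟨fun t => Z ⌊t⌋₊ t, by simpa using hZ0 0, fun t ht => ?_⟩
  have htN : t < ⌊t⌋₊ + 1 := Nat.lt_floor_add_one t
  have hnhds : Ico (0 : ℝ) (⌊t⌋₊ + 1) ∈ 𝓝[Ici 0] t :=
    inter_mem self_mem_nhdsWithin (mem_nhdsWithin_of_mem_nhds (Iio_mem_nhds htN))
  refine HasDerivWithinAt.congr_of_eventuallyEq_of_mem ((hZ ⌊t⌋₊ t ⟨ht, htN.le⟩).mono_of_mem_nhdsWithin
    (mem_of_superset hnhds Ico_subset_Icc_self)) ?_ ht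
  filter_upwards [hnhds] with r hr using hz _ r hr

/-- A `C¹` vector field has global forward solutions if all its time rescalings by factors in
`[0, 1]` satisfy an a priori bound on every bounded time interval. -/
theorem exists_global_solution_of_rescaled_bound [FiniteDimensional ℝ E] [HasContDiffBump E]
    {F : E → E} (hF : ContDiff ℝ 1 F) {z₀ : E}
    (hbound : ∀ T > 0, ∃ R, ∀ (θ : ℝ → ℝ) (z : ℝ → E), (∀ t, θ t ∈ Icc (0 : ℝ) 1) →
      (∀ t ∈ Icc 0 T, HasDerivWithinAt z (θ t • F (z t)) (Icc 0 T) t) → z 0 = z₀ →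
      ∀ t ∈ Icc 0 T, ‖z t‖ ≤ R) :
    ∃ z : ℝ → E, z 0 = z₀ ∧ ∀ t ∈ Ici 0, HasDerivWithinAt z (F (z t)) (Ici 0) t := by
  have : CompleteSpace E := FiniteDimensional.complete ℝ E
  refine exists_solution_Ici_of_forall_exists_solution_Icc hF fun T hT => ?_
  obtain ⟨R, hR⟩ := hbound T hT
  let χ : ContDiffBump (0 : E) := ⟨|R| + 1, |R| + 2, by positivity, by linarith⟩
  obtain ⟨z, hz0, hz⟩ := exists_solution_of_contDiff_of_hasCompactSupport
    (F := fun x => χ x • F x) (χ.contDiff.smul hF) χ.hasCompactSupport.smul_right z₀ hT.le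
  refine ⟨z, hz0, fun t ht => (hz t ht).congr_deriv ?_⟩
  -- The cut-off solution is a rescaled solution with `θ t = χ (z t)`; the a priori bound confines
  -- it to the region where `χ = 1`.
  have := hR (fun t => χ (z t)) z (fun t => ⟨χ.nonneg, χ.le_one⟩) hz hz0 t ht
  rw [χ.one_of_mem_closedBall, one_smul]
  rw [mem_closedBall_zero_iff]
  exact this.trans (by linarith [le_abs_self R])

end ODE

/-! ### Bounds from periodicity; comparison of energy and error. -/

section Bounds

variable {n : ℕ}

lemma Function.Periodic.deriv_periodic {E : Type*} [NormedAddCommGroup E] [NormedSpace ℝ E]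
    {f : ℝ → E} {p : ℝ} (h : Function.Periodic f p) : Function.Periodic (deriv f) p := by
  intro t
  rw [← deriv_comp_add_const, h.funext]

lemma exists_bound_of_periodic {f : ℝ → Joint n} (hf : ContDiff ℝ 3 f) {p : ℝ} (hp0 : 0 < p)
    (hp : Function.Periodic f p) :
    ∃ M > 0, ∀ τ, ‖f τ‖ ≤ M ∧ ‖deriv f τ‖ ≤ M ∧ ‖deriv (deriv f) τ‖ ≤ M := by
  obtain ⟨d0, d1, d2⟩ := differentiable_deriv_of_contDiff hf
  obtain ⟨a, ha⟩ := (hp.isBounded_of_continuous hp0.ne' d0.continuous).exists_norm_le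
  obtain ⟨b, hb⟩ := (hp.deriv_periodic.isBounded_of_continuous hp0.ne' d1.continuous).exists_norm_le
  obtain ⟨c, hc⟩ := (hp.deriv_periodic.deriv_periodic.isBounded_of_continuous hp0.ne'
    d2.continuous).exists_norm_le
  simp only [mem_range, forall_exists_index, forall_apply_eq_imp_iff] at ha hb hc
  have ha0 := (norm_nonneg _).trans (ha 0)
  have hb0 := (norm_nonneg _).trans (hb 0)
  have hc0 := (norm_nonneg _).trans (hc 0)
  exact ⟨a + b + c + 1, by positivity, fun τ => ⟨(ha τ).trans (by linarith),
    (hb τ).trans (by linarith), (hc τ).trans (by linarith)⟩⟩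

lemma norm_sub_desired_sq (f : ℝ → Joint n) (z : OscState n) :
    ‖z.fst - desired f z.snd‖ ^ 2 = ‖posErr f z‖ ^ 2 + ‖velErr f z‖ ^ 2 := by
  rw [WithLp.prod_norm_sq_eq_of_L2]
  rfl

lemma norm_posErr_le (f : ℝ → Joint n) (z : OscState n) :
    ‖posErr f z‖ ≤ ‖z.fst - desired f z.snd‖ :=
  WithLp.norm_fst_le _ (z.fst - desired f z.snd)

lemma norm_velErr_le (f : ℝ → Joint n) (z : OscState n) :
    ‖velErr f z‖ ≤ ‖z.fst - desired f z.snd‖ :=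
  WithLp.norm_snd_le _ (z.fst - desired f z.snd)

lemma exists_lyap_bounds {K : Matrix (Fin n) (Fin n) ℝ} (hK : K.PosDef) :
    ∃ a > 0, ∃ b > 0, ∀ (f : ℝ → Joint n) (z : OscState n),
      a * ‖z.fst - desired f z.snd‖ ^ 2 ≤ lyap f K z ∧
      lyap f K z ≤ b * ‖z.fst - desired f z.snd‖ ^ 2 := by
  obtain ⟨k, hk, hkK⟩ := exists_coercive hK
  obtain ⟨C, hC, hCK⟩ := norm_act_le K
  refine ⟨min k 1 / 2, by positivity, (C + 1) / 2, by positivity, fun f z => ?_⟩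
  rw [norm_sub_desired_sq, lyap, real_inner_self_eq_norm_sq]
  have h1 := hkK (posErr f z)
  have h2 : inner ℝ (posErr f z) (act K (posErr f z)) ≤ C * ‖posErr f z‖ ^ 2 :=
    (real_inner_le_norm _ _).trans <| by
      calc _ ≤ ‖posErr f z‖ * (C * ‖posErr f z‖) := by gcongr; exact hCK _
        _ = _ := by ring
  constructor
  · have := mul_le_mul_of_nonneg_right (min_le_left k 1) (sq_nonneg ‖posErr f z‖)
    have := mul_le_mul_of_nonneg_right (min_le_right k 1) (sq_nonneg ‖velErr f z‖)
    linarith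
  · nlinarith [sq_nonneg ‖posErr f z‖, mul_nonneg hC.le (sq_nonneg ‖velErr f z‖)]

lemma exists_coupling_bound (K : Matrix (Fin n) (Fin n) ℝ) {f : ℝ → Joint n} {M : ℝ} (hM : 0 < M)
    (hfM : ∀ τ, ‖f τ‖ ≤ M ∧ ‖deriv f τ‖ ≤ M ∧ ‖deriv (deriv f) τ‖ ≤ M) :
    ∃ C > 0, ∀ z, |coupling f K z| ≤ C * ‖z.fst - desired f z.snd‖ := by
  obtain ⟨C, hC, hCK⟩ := norm_act_le K
  refine ⟨C * M + M, by positivity, fun z => ?_⟩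
  have h1 : |inner ℝ (posErr f z) (act K (deriv f z.snd))| ≤
      ‖z.fst - desired f z.snd‖ * (C * M) := by
    refine (abs_real_inner_le_norm _ _).trans ?_
    gcongr
    · exact norm_posErr_le f z
    · exact (hCK _).trans (by gcongr; exact (hfM _).2.1)
  have h2 : |inner ℝ (velErr f z) (deriv (deriv f) z.snd)| ≤
      ‖z.fst - desired f z.snd‖ * M := by
    refine (abs_real_inner_le_norm _ _).trans ?_
    gcongr
    · exact norm_velErr_le f z
    · exact (hfM _).2.2
  exact (abs_add_le _ _).trans (by linarith)

end Bounds

instance instContinuousSMulWithLpProd {E F : Type*} [NormedAddCommGroup E] [NormedSpace ℝ E]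
    [NormedAddCommGroup F] [NormedSpace ℝ F] : ContinuousSMul ℝ (WithLp 2 (E × F)) where
  continuous_smul := by
    have h : Continuous fun x : ℝ × WithLp 2 (E × F) => x.1 • x.2.ofLp :=
      continuous_fst.smul ((WithLp.prod_continuous_ofLp 2 E F).comp continuous_snd)
    exact (WithLp.prod_continuous_toLp 2 E F).comp h

/-! ### The oscillator as a `C¹` vector field; global solutions. -/

section Existence

variable {n : ℕ} {f : ℝ → Joint n} {B K : Matrix (Fin n) (Fin n) ℝ} {γ : ℝ}

/-- The vector field of the programmable oscillator. -/
noncomputable def oscField (f : ℝ → Joint n) (B K : Matrix (Fin n) (Fin n) ℝ) (γ : ℝ)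
    (z : OscState n) : OscState n :=
  WithLp.toLp 2 (WithLp.toLp 2 (z.fst.snd, oscAccel f B K z), oscPhaseVel f K γ z)

lemma hasDerivWithinAt_withLp_prod_iff {E F : Type*} [NormedAddCommGroup E] [NormedSpace ℝ E]
    [NormedAddCommGroup F] [NormedSpace ℝ F] {z : ℝ → WithLp 2 (E × F)} {z' : WithLp 2 (E × F)}
    {I : Set ℝ} {t : ℝ} :
    HasDerivWithinAt z z' I t ↔ HasDerivWithinAt (fun r => (z r).fst) z'.fst I t ∧
      HasDerivWithinAt (fun r => (z r).snd) z'.snd I t := by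
  let e := WithLp.prodContinuousLinearEquiv 2 ℝ E F
  constructor
  · intro h
    have := e.hasFDerivAt.comp_hasDerivWithinAt t h
    exact ⟨(ContinuousLinearMap.fst ℝ E F).hasFDerivAt.comp_hasDerivWithinAt t this,
      (ContinuousLinearMap.snd ℝ E F).hasFDerivAt.comp_hasDerivWithinAt t this⟩
  · intro h
    exact e.symm.hasFDerivAt.comp_hasDerivWithinAt t (h.1.prodMk h.2)

lemma hasDerivWithinAt_oscState_iff {z : ℝ → OscState n} {z' : OscState n} {I : Set ℝ} {t : ℝ} :
    HasDerivWithinAt z z' I t ↔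
      HasDerivWithinAt (fun r => (z r).fst.fst) z'.fst.fst I t ∧
      HasDerivWithinAt (fun r => (z r).fst.snd) z'.fst.snd I t ∧
      HasDerivWithinAt (fun r => (z r).snd) z'.snd I t := by
  rw [hasDerivWithinAt_withLp_prod_iff, hasDerivWithinAt_withLp_prod_iff, and_assoc]

lemma isOscSolutionOn_iff {I : Set ℝ} {z : ℝ → OscState n} :
    IsOscSolutionOn f B K γ I z ↔
      ∀ t ∈ I, HasDerivWithinAt z (oscField f B K γ (z t)) I t := by
  simp only [hasDerivWithinAt_oscState_iff]
  rfl

lemma IsOscSolutionOn.mono {I J : Set ℝ} {z : ℝ → OscState n} (h : IsOscSolutionOn f B K γ J z)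
    (hIJ : I ⊆ J) : IsOscSolutionOn f B K γ I z := fun t ht =>
  ⟨(h t (hIJ ht)).1.mono hIJ, (h t (hIJ ht)).2.1.mono hIJ, (h t (hIJ ht)).2.2.mono hIJ⟩

lemma contDiff_withLp_prod_fst {E F : Type*} [NormedAddCommGroup E] [NormedSpace ℝ E]
    [NormedAddCommGroup F] [NormedSpace ℝ F] {m : WithTop ℕ∞} :
    ContDiff ℝ m fun z : WithLp 2 (E × F) => z.fst :=
  contDiff_fst.comp WithLp.contDiff_ofLp

lemma contDiff_withLp_prod_snd {E F : Type*} [NormedAddCommGroup E] [NormedSpace ℝ E]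
    [NormedAddCommGroup F] [NormedSpace ℝ F] {m : WithTop ℕ∞} :
    ContDiff ℝ m fun z : WithLp 2 (E × F) => z.snd :=
  contDiff_snd.comp WithLp.contDiff_ofLp

lemma contDiff_posErr (hf : ContDiff ℝ 3 f) : ContDiff ℝ 1 (posErr f) :=
  (contDiff_withLp_prod_fst.comp contDiff_withLp_prod_fst).sub
    ((hf.of_le (by norm_num)).comp contDiff_withLp_prod_snd)

lemma contDiff_deriv (hf : ContDiff ℝ 3 f) : ContDiff ℝ 1 (deriv f) :=
  contDiff_one_iff_deriv.2 ⟨(differentiable_deriv_of_contDiff hf).2.1,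
    (differentiable_deriv_of_contDiff hf).2.2.continuous⟩

lemma contDiff_velErr (hf : ContDiff ℝ 3 f) : ContDiff ℝ 1 (velErr f) :=
  (contDiff_withLp_prod_snd.comp contDiff_withLp_prod_fst).sub
    ((contDiff_deriv hf).comp contDiff_withLp_prod_snd)

lemma contDiff_act (A : Matrix (Fin n) (Fin n) ℝ) {m : WithTop ℕ∞} : ContDiff ℝ m (act A) :=
  (Matrix.toEuclideanCLM (𝕜 := ℝ) A).contDiff

lemma contDiff_coupling (hf : ContDiff ℝ 3 f) : ContDiff ℝ 1 (coupling f K) :=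
  ((contDiff_posErr hf).inner ℝ
      ((contDiff_act K).comp ((contDiff_deriv hf).comp contDiff_withLp_prod_snd))).add
    ((contDiff_velErr hf).inner ℝ
      ((differentiable_deriv_of_contDiff hf).2.2.comp contDiff_withLp_prod_snd))

lemma contDiff_lyap (hf : ContDiff ℝ 3 f) : ContDiff ℝ 1 (lyap f K) :=
  (((contDiff_posErr hf).inner ℝ ((contDiff_act K).comp (contDiff_posErr hf))).add
    ((contDiff_velErr hf).inner ℝ (contDiff_velErr hf))).div_const 2

lemma contDiff_oscField (hf : ContDiff ℝ 3 f) : ContDiff ℝ 1 (oscField f B K γ) := by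
  have ha : ContDiff ℝ 1 (oscAccel f B K) :=
    (((differentiable_deriv_of_contDiff hf).2.2.comp contDiff_withLp_prod_snd).sub
      ((contDiff_act B).comp (contDiff_velErr hf))).sub ((contDiff_act K).comp (contDiff_posErr hf))
  have hp : ContDiff ℝ 1 (oscPhaseVel f K γ) :=
    contDiff_const.add (contDiff_const.mul (contDiff_coupling hf))
  exact WithLp.contDiff_toLp.comp ((WithLp.contDiff_toLp.comp
    ((contDiff_withLp_prod_snd.comp contDiff_withLp_prod_fst).prodMk ha)).prodMk hp)

lemma lyap_le_of_rescaled_solution (hf : ContDiff ℝ 3 f) (hB : B.PosDef) (hK : K.PosDef)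
    (hγ : 0 ≤ γ) {θ : ℝ → ℝ} {z : ℝ → OscState n} {a b : ℝ} (hab : a ≤ b) (hθ : ∀ t, 0 ≤ θ t)
    (hz : ∀ t ∈ Icc a b, HasDerivWithinAt z (θ t • oscField f B K γ (z t)) (Icc a b) t) :
    lyap f K (z b) ≤ lyap f K (z a) := by
  have h := image_sub_le_of_hasDerivWithinAt_le (C := 0) hab (fun t ht => by
    obtain ⟨h₁, h₂, h₃⟩ := hasDerivWithinAt_oscState_iff.1 (hz t ht)
    exact hasDerivWithinAt_lyap hf hK h₁ h₂ h₃) (fun t _ => by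
      obtain ⟨k, hk, hkB⟩ := exists_coercive hB
      have h1 : 0 ≤ inner ℝ (velErr f (z t)) (act B (velErr f (z t))) :=
        le_trans (by positivity) (hkB _)
      have h2 : 0 ≤ γ * coupling f K (z t) ^ 2 := by positivity
      exact mul_nonpos_of_nonneg_of_nonpos (hθ t) (by linarith))
  simpa using h

lemma norm_oscState_le (z : OscState n) : ‖z‖ ≤ ‖z.fst.fst‖ + ‖z.fst.snd‖ + |z.snd| := by
  have h : ∀ {E F : Type} [NormedAddCommGroup E] [NormedAddCommGroup F] (x : WithLp 2 (E × F)),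
      ‖x‖ ≤ ‖x.fst‖ + ‖x.snd‖ := fun x => by
    refine abs_le_of_sq_le_sq' ?_ (by positivity) |>.2
    rw [WithLp.prod_norm_sq_eq_of_L2]
    nlinarith [mul_nonneg (norm_nonneg x.fst) (norm_nonneg x.snd)]
  exact (h z).trans (by gcongr; exacts [h _, le_rfl])

/-- The energy bounds the error by `D`, hence the coupling by `C * D` and the phase speed by `1 + γ
* (C * D)`; a factor `θ ≤ 1` can only slow the phase. -/
lemma exists_rescaled_bound (hf : ContDiff ℝ 3 f) {p : ℝ} (hp0 : 0 < p)
    (hp : Function.Periodic f p) (hB : B.PosDef) (hK : K.PosDef) (hγ : 0 ≤ γ) (z₀ : OscState n)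
    (T : ℝ) :
    ∃ R, ∀ (θ : ℝ → ℝ) (z : ℝ → OscState n), (∀ t, θ t ∈ Icc (0 : ℝ) 1) →
      (∀ t ∈ Icc 0 T, HasDerivWithinAt z (θ t • oscField f B K γ (z t)) (Icc 0 T) t) →
      z 0 = z₀ → ∀ t ∈ Icc 0 T, ‖z t‖ ≤ R := by
  obtain ⟨M, hM, hfM⟩ := exists_bound_of_periodic hf hp0 hp
  obtain ⟨a, ha, b, hb, hab⟩ := exists_lyap_bounds hK
  obtain ⟨C, hC, hCg⟩ := exists_coupling_bound K hM hfM
  obtain ⟨D, hD⟩ : ∃ D, D = √(lyap f K z₀ / a) := ⟨_, rfl⟩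
  refine ⟨(D + M) + (D + M) + (|z₀.snd| + (1 + γ * (C * D)) * T), fun θ z hθ hz h0 t ht => ?_⟩
  have herr : ∀ s ∈ Icc 0 T, ‖(z s).fst - desired f (z s).snd‖ ≤ D := fun s hs => by
    have hle := lyap_le_of_rescaled_solution hf hB hK hγ hs.1 (fun t => (hθ t).1)
      (fun r hr => (hz r ⟨hr.1, hr.2.trans hs.2⟩).mono (Icc_subset_Icc_right hs.2))
    rw [h0] at hle
    rw [hD]
    refine Real.le_sqrt_of_sq_le ?_
    rw [le_div_iff₀ ha, mul_comm]
    exact ((hab f (z s)).1).trans hle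
  have hD0 : 0 ≤ D := (norm_nonneg _).trans (herr t ht)
  have h1 : ‖(z t).fst.fst‖ ≤ D + M := by
    have := norm_add_le (posErr f (z t)) (f (z t).snd)
    rw [posErr, sub_add_cancel] at this
    exact this.trans (add_le_add ((norm_posErr_le f _).trans (herr t ht)) (hfM _).1)
  have h2 : ‖(z t).fst.snd‖ ≤ D + M := by
    have := norm_add_le (velErr f (z t)) (deriv f (z t).snd)
    rw [velErr, sub_add_cancel] at this
    exact this.trans (add_le_add ((norm_velErr_le f _).trans (herr t ht)) (hfM _).2.1)
  have h3 : |(z t).snd| ≤ |z₀.snd| + (1 + γ * (C * D)) * T := by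
    have hv : ∀ s ∈ Icc 0 T, ‖θ s * oscPhaseVel f K γ (z s)‖ ≤ 1 + γ * (C * D) := fun s hs => by
      have hg : |coupling f K (z s)| ≤ C * D :=
        (hCg _).trans (by gcongr; exact herr s hs)
      have h1 : |oscPhaseVel f K γ (z s)| ≤ 1 + γ * (C * D) := by
        refine (abs_add_le 1 (γ * coupling f K (z s))).trans ?_
        rw [abs_one, abs_mul, abs_of_nonneg hγ]
        gcongr
      rw [norm_mul, Real.norm_eq_abs, Real.norm_eq_abs, abs_of_nonneg (hθ s).1]
      exact (mul_le_of_le_one_left (abs_nonneg _) (hθ s).2).trans h1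
    have := (convex_Icc 0 T).norm_image_sub_le_of_norm_hasDerivWithin_le
      (fun s hs => (hasDerivWithinAt_oscState_iff.1 (hz s hs)).2.2) hv
      (left_mem_Icc.2 (ht.1.trans ht.2)) ht
    rw [h0, sub_zero, Real.norm_eq_abs, Real.norm_eq_abs, abs_of_nonneg ht.1] at this
    have h4 := abs_add_le ((z t).snd - z₀.snd) z₀.snd
    rw [sub_add_cancel] at h4
    have h5 : (1 + γ * (C * D)) * t ≤ (1 + γ * (C * D)) * T := by gcongr; exact ht.2
    linarith
  exact (norm_oscState_le _).trans (by linarith)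

theorem exists_unique_oscSolution (hf : ContDiff ℝ 3 f) (hper : ∃ p > 0, Function.Periodic f p)
    (hB : B.PosDef) (hK : K.PosDef) (hγ : 0 ≤ γ) (z₀ : OscState n) :
    ∃ z, IsOscSolution f B K γ z ∧ z 0 = z₀ ∧
      ∀ T > 0, ∀ w, IsOscSolutionOn f B K γ (Ico 0 T) w → w 0 = z₀ → EqOn w z (Ico 0 T) := by
  obtain ⟨p, hp0, hp⟩ := hper
  obtain ⟨z, hz0, hz⟩ := exists_global_solution_of_rescaled_bound
    (contDiff_oscField (B := B) (K := K) (γ := γ) hf)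
    (fun T _ => exists_rescaled_bound hf hp0 hp hB hK hγ z₀ T)
  refine ⟨z, isOscSolutionOn_iff.2 hz, hz0, fun T _ w hw hw0 t ht => ?_⟩
  -- The competitor is only given on `[0, T)`, so uniqueness is applied on `[0, t]` for each `t <
  -- T`.
  exact eqOn_of_hasDerivWithinAt_of_contDiff (contDiff_oscField hf)
    (isOscSolutionOn_iff.1 (hw.mono (Icc_subset_Ico_right ht.2)))
    (fun s hs => (hz s hs.1).mono Icc_subset_Ici_self) (by rw [hw0, hz0]) ⟨ht.1, le_rfl⟩

end Existence

/-! ### Convergence, and stability in state space. -/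

section Stability

variable {n : ℕ} {f : ℝ → Joint n} {B K : Matrix (Fin n) (Fin n) ℝ} {γ : ℝ} {z : ℝ → OscState n}

lemma lyap_antitoneOn (hf : ContDiff ℝ 3 f) (hB : B.PosDef) (hK : K.PosDef) (hγ : 0 ≤ γ)
    (hz : IsOscSolution f B K γ z) : AntitoneOn (fun t => lyap f K (z t)) (Ici 0) :=
  fun a ha _ _ hab => lyap_le_of_rescaled_solution hf hB hK hγ (θ := fun _ => 1) hab
    (fun _ => zero_le_one) (fun t ht => by
      rw [one_smul]
      exact (isOscSolutionOn_iff.1 hz t (le_trans ha ht.1)).mono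
        (fun r hr => le_trans ha hr.1))

/-- The constant is chosen before `γ`; all stability uniform in `γ` rests on this. -/
lemma exists_norm_sub_desired_le (hf : ContDiff ℝ 3 f) (hB : B.PosDef) (hK : K.PosDef) :
    ∃ C > 0, ∀ γ ≥ (0 : ℝ), ∀ z, IsOscSolution f B K γ z → ∀ s ≥ (0 : ℝ), ∀ t ≥ s,
      ‖(z t).fst - desired f (z t).snd‖ ≤ C * ‖(z s).fst - desired f (z s).snd‖ := by
  obtain ⟨a, ha, b, hb, hab⟩ := exists_lyap_bounds hK
  refine ⟨√(b / a), by positivity, fun γ hγ z hz s hs t hst => ?_⟩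
  have h := lyap_antitoneOn hf hB hK hγ hz hs (le_trans hs hst) hst
  refine abs_le_of_sq_le_sq' ?_ (by positivity) |>.2
  rw [mul_pow, Real.sq_sqrt (by positivity), div_mul_eq_mul_div, le_div_iff₀ ha, mul_comm]
  exact ((hab f (z t)).1.trans h).trans (hab f (z s)).2

/-- Here `P`, `Q` stand for the norms of the two errors and `g` for the coupling. Young's inequality
absorbs the mixed terms into `k * P ^ 2`, at the price of multiples of `Q ^ 2` and `γ * g ^ 2`,
which the damping and the phase feedback pay for once `c` is small. The resulting `c` and `κ` depend
on `γ`. -/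
lemma strict_lyap_estimate {b k β M γ : ℝ} (hb : 0 < b) (hk : 0 < k) (hγ : 0 ≤ γ) {a : ℝ}
    (ha : 0 < a) :
    ∃ c > 0, c ≤ 2 * a ∧ ∃ κ > 0, ∀ P Q g : ℝ,
      -(b * Q ^ 2) - γ * g ^ 2
        + c * (Q ^ 2 - k * P ^ 2 + β * P * Q + γ * |g| * (M * Q + M * P))
      ≤ -κ * (P ^ 2 + Q ^ 2) := by
  -- `A` and `G` collect the coefficients of `Q ^ 2` and `γ * g ^ 2` produced by Young's inequality.
  set A := 2 + β ^ 2 / k with hA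
  set G := γ * M ^ 2 * (1 / k + 1 / 4) with hG
  have hA0 : 0 < A := by positivity
  have hG0 : 0 ≤ G := by positivity
  set c := min (min (b / (2 * A)) (1 / (G + 1))) (2 * a) with hc
  have hc0 : 0 < c := by positivity
  have h1 : c * A ≤ b / 2 := by
    have : c ≤ b / (2 * A) := (min_le_left _ _).trans (min_le_left _ _)
    rw [le_div_iff₀ (by positivity)] at this
    linarith
  have h2 : c * G ≤ 1 := by
    have : c ≤ 1 / (G + 1) := (min_le_left _ _).trans (min_le_right _ _)
    rw [le_div_iff₀ (by positivity)] at this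
    linarith
  refine ⟨c, hc0, min_le_right _ _, min (c * k / 2) (b / 2), by positivity, fun P Q g => ?_⟩
  have e1 : β * P * Q ≤ k / 4 * P ^ 2 + β ^ 2 / k * Q ^ 2 := by
    have : 0 ≤ (k / 2 * P - β * Q) ^ 2 / k := by positivity
    have e : (k / 2 * P - β * Q) ^ 2 / k = k / 4 * P ^ 2 - β * P * Q + β ^ 2 / k * Q ^ 2 := by
      field_simp
      ring
    linarith
  have e2 : γ * |g| * (M * P) ≤ k / 4 * P ^ 2 + γ ^ 2 * g ^ 2 * M ^ 2 / k := by
    have : 0 ≤ (k / 2 * P - γ * |g| * M) ^ 2 / k := by positivity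
    have e : (k / 2 * P - γ * |g| * M) ^ 2 / k
        = k / 4 * P ^ 2 - γ * |g| * (M * P) + γ ^ 2 * |g| ^ 2 * M ^ 2 / k := by
      field_simp
      ring
    rw [sq_abs] at e
    linarith
  have e3 : γ * |g| * (M * Q) ≤ Q ^ 2 + γ ^ 2 * g ^ 2 * M ^ 2 / 4 := by
    have := sq_nonneg (Q - γ * |g| * M / 2)
    have e : (Q - γ * |g| * M / 2) ^ 2
        = Q ^ 2 - γ * |g| * (M * Q) + γ ^ 2 * |g| ^ 2 * M ^ 2 / 4 := by ring
    rw [sq_abs] at e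
    linarith
  have e4 : Q ^ 2 - k * P ^ 2 + β * P * Q + γ * |g| * (M * Q + M * P)
      ≤ A * Q ^ 2 - k / 2 * P ^ 2 + γ * g ^ 2 * G := by
    have : γ * g ^ 2 * G = γ ^ 2 * g ^ 2 * M ^ 2 / k + γ ^ 2 * g ^ 2 * M ^ 2 / 4 := by
      rw [hG]
      ring
    rw [this, hA]
    nlinarith
  have e5 := mul_le_mul_of_nonneg_left e4 hc0.le
  have e6 := mul_le_mul_of_nonneg_right h1 (sq_nonneg Q)
  have e7 := mul_le_mul_of_nonneg_right h2 (show 0 ≤ γ * g ^ 2 by positivity)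
  have e8 := mul_le_mul_of_nonneg_right (min_le_left (c * k / 2) (b / 2)) (sq_nonneg P)
  have e9 := mul_le_mul_of_nonneg_right (min_le_right (c * k / 2) (b / 2)) (sq_nonneg Q)
  nlinarith

lemma exists_lyap_lt (hf : ContDiff ℝ 3 f) (hper : ∃ p > 0, Function.Periodic f p)
    (hB : B.PosDef) (hK : K.PosDef) (hγ : 0 ≤ γ) (hz : IsOscSolution f B K γ z) {ε : ℝ}
    (hε : 0 < ε) : ∃ t ≥ 0, lyap f K (z t) < ε := by
  obtain ⟨p, hp0, hp⟩ := hper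
  obtain ⟨M, hM, hfM⟩ := exists_bound_of_periodic hf hp0 hp
  obtain ⟨a, ha, d, hd, had⟩ := exists_lyap_bounds hK
  obtain ⟨k, hk, hkK⟩ := exists_coercive hK
  obtain ⟨b, hb, hbB⟩ := exists_coercive hB
  obtain ⟨β, hβ, hβB⟩ := norm_act_le B
  obtain ⟨c, hc, hca, κ, hκ, hest⟩ := strict_lyap_estimate (β := β) (M := M) hb hk hγ ha
  by_contra! hcon
  let W : ℝ → ℝ := fun t => lyap f K (z t) + c * inner ℝ (posErr f (z t)) (velErr f (z t))
  -- Nonnegativity uses `c ≤ 2 * a` and `2PQ ≤ P² + Q²`.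
  have hW0 : ∀ t, 0 ≤ W t := fun t => by
    have h1 := (had f (z t)).1
    rw [norm_sub_desired_sq] at h1
    have h2 := neg_le_of_abs_le (abs_real_inner_le_norm (posErr f (z t)) (velErr f (z t)))
    have h3 := mul_le_mul_of_nonneg_left h2 hc.le
    have h4 := two_mul_le_add_sq ‖posErr f (z t)‖ ‖velErr f (z t)‖
    have h5 := mul_nonneg (norm_nonneg (posErr f (z t))) (norm_nonneg (velErr f (z t)))
    change 0 ≤ lyap f K (z t) + c * inner ℝ (posErr f (z t)) (velErr f (z t))
    nlinarith
  set η := κ * (ε / d) with hη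
  have hη0 : 0 < η := by positivity
  -- If the energy stayed at least `ε`, then `W` would fall at rate at least `η` and be at most `-η`
  -- at this time.
  set T := W 0 / η + 1 with hT
  have hT0 : 0 ≤ T := add_nonneg (div_nonneg (hW0 0) hη0.le) zero_le_one
  have hdrop : W T ≤ W 0 + -η * (T - 0) := by
    refine image_sub_le_of_hasDerivWithinAt_le hT0 (fun t ht => ?_) (u' := fun t =>
      (1 * (-inner ℝ (velErr f (z t)) (act B (velErr f (z t))) - γ * coupling f K (z t) ^ 2))
      + c * (inner ℝ (velErr f (z t)) (velErr f (z t))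
        - inner ℝ (posErr f (z t)) (act K (posErr f (z t)))
        - inner ℝ (posErr f (z t)) (act B (velErr f (z t)))
        - γ * coupling f K (z t) * (inner ℝ (deriv f (z t).snd) (velErr f (z t))
          + inner ℝ (posErr f (z t)) (deriv (deriv f) (z t).snd)))) (fun t ht => ?_)
    · obtain ⟨h₁, h₂, h₃⟩ := hz.mono (I := Icc 0 T) Icc_subset_Ici_self t ht
      exact (hasDerivWithinAt_lyap (θ := 1) hf hK (by simpa using h₁) (by simpa using h₂)
        (by simpa using h₃)).add ((hasDerivWithinAt_inner_posErr_velErr hf h₁ h₂ h₃).const_mul c)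
    · set P := ‖posErr f (z t)‖ with hP
      set Q := ‖velErr f (z t)‖ with hQ
      have h1 : ε / d ≤ P ^ 2 + Q ^ 2 := by
        rw [div_le_iff₀ hd, mul_comm, ← norm_sub_desired_sq]
        exact (hcon t ht.1).trans (had f (z t)).2
      have h2 := hkK (posErr f (z t))
      have h3 := hbB (velErr f (z t))
      have h4 : -inner ℝ (posErr f (z t)) (act B (velErr f (z t))) ≤ β * P * Q :=
        (neg_le_of_neg_le (neg_le_of_abs_le (abs_real_inner_le_norm _ _))).trans <| by
          calc _ ≤ P * (β * Q) := by gcongr; exact hβB _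
            _ = _ := by ring
      have h5 : -(γ * coupling f K (z t) * (inner ℝ (deriv f (z t).snd) (velErr f (z t))
          + inner ℝ (posErr f (z t)) (deriv (deriv f) (z t).snd)))
          ≤ γ * |coupling f K (z t)| * (M * Q + M * P) := by
        refine (neg_le_abs _).trans ?_
        rw [abs_mul, abs_mul, abs_of_nonneg hγ]
        gcongr
        refine (abs_add_le _ _).trans (add_le_add ?_ ?_)
        · refine (abs_real_inner_le_norm _ _).trans ?_
          gcongr
          exact (hfM _).2.1
        · refine (abs_real_inner_le_norm _ _).trans ?_
          rw [mul_comm]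
          gcongr
          exact (hfM _).2.2
      have h6 := hest P Q (coupling f K (z t))
      have h7 := mul_le_mul_of_nonneg_left h1 hκ.le
      rw [real_inner_self_eq_norm_sq]
      have h8 : Q ^ 2 - inner ℝ (posErr f (z t)) (act K (posErr f (z t)))
        - inner ℝ (posErr f (z t)) (act B (velErr f (z t)))
        - γ * coupling f K (z t) * (inner ℝ (deriv f (z t).snd) (velErr f (z t))
          + inner ℝ (posErr f (z t)) (deriv (deriv f) (z t).snd))
        ≤ Q ^ 2 - k * P ^ 2 + β * P * Q + γ * |coupling f K (z t)| * (M * Q + M * P) := by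
        linarith
      have h9 := mul_le_mul_of_nonneg_left h8 hc.le
      linarith
  have h1 : η * T = W 0 + η := by
    rw [hT]
    field_simp
  linarith [hW0 T]

theorem tendsto_sub_desired (hf : ContDiff ℝ 3 f) (hper : ∃ p > 0, Function.Periodic f p)
    (hB : B.PosDef) (hK : K.PosDef) (hγ : 0 ≤ γ) (hz : IsOscSolution f B K γ z) :
    Tendsto (fun t => (z t).fst - desired f (z t).snd) atTop (𝓝 0) := by
  obtain ⟨a, ha, b, hb, hab⟩ := exists_lyap_bounds hK
  rw [Metric.tendsto_atTop]
  intro ε hε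
  obtain ⟨s, hs, hlt⟩ := exists_lyap_lt hf hper hB hK hγ hz (ε := a * ε ^ 2) (by positivity)
  refine ⟨s, fun t ht => ?_⟩
  rw [dist_zero_right]
  have h := lyap_antitoneOn hf hB hK hγ hz hs (le_trans hs ht) ht
  refine abs_lt_of_sq_lt_sq' ?_ hε.le |>.2
  exact lt_of_mul_lt_mul_left (((hab f (z t)).1.trans h).trans_lt hlt) ha.le

lemma exists_norm_desired_le (hf : ContDiff ℝ 3 f) (hper : ∃ p > 0, Function.Periodic f p) :
    ∃ M, ∀ τ, ‖desired f τ‖ ≤ M := by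
  obtain ⟨p, hp0, hp⟩ := hper
  obtain ⟨M, hM, hfM⟩ := exists_bound_of_periodic hf hp0 hp
  refine ⟨M + M, fun τ => ?_⟩
  refine abs_le_of_sq_le_sq' ?_ (by positivity) |>.2
  rw [WithLp.prod_norm_sq_eq_of_L2]
  change ‖f τ‖ ^ 2 + ‖deriv f τ‖ ^ 2 ≤ _
  nlinarith [(hfM τ).1, (hfM τ).2.1, norm_nonneg (f τ), norm_nonneg (deriv f τ)]

theorem isBounded_shape (hf : ContDiff ℝ 3 f) (hper : ∃ p > 0, Function.Periodic f p)
    (hB : B.PosDef) (hK : K.PosDef) (hγ : 0 ≤ γ) (hz : IsOscSolution f B K γ z) :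
    Bornology.IsBounded ((fun t => (z t).fst) '' Ici 0) := by
  obtain ⟨M, hM⟩ := exists_norm_desired_le hf hper
  obtain ⟨C, hC, hCz⟩ := exists_norm_sub_desired_le hf hB hK
  rw [isBounded_iff_forall_norm_le]
  refine ⟨C * ‖(z 0).fst - desired f (z 0).snd‖ + M, ?_⟩
  rintro _ ⟨t, ht, rfl⟩
  have := norm_add_le ((z t).fst - desired f (z t).snd) (desired f (z t).snd)
  rw [sub_add_cancel] at this
  exact this.trans (add_le_add (hCz γ hγ z hz 0 le_rfl t ht) (hM _))

lemma isOscSolution_desiredState (hf : ContDiff ℝ 3 f) (γ φ₀ : ℝ) :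
    IsOscSolution f B K γ (fun t => desiredState f (t + φ₀)) := by
  obtain ⟨d0, d1, -⟩ := differentiable_deriv_of_contDiff hf
  intro t _
  refine ⟨?_, ?_, ?_⟩
  · exact ((d0 (t + φ₀)).hasDerivAt.comp_add_const t φ₀).hasDerivWithinAt
  · refine ((d1 (t + φ₀)).hasDerivAt.comp_add_const t φ₀).hasDerivWithinAt.congr_deriv ?_
    simp [oscAccel, desiredState, desired, act_zero]
  · refine ((hasDerivAt_id t).add_const φ₀).hasDerivWithinAt.congr_deriv ?_
    simp [oscPhaseVel, desiredState, desired]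

lemma exists_desired_lipschitz (hf : ContDiff ℝ 3 f) (hper : ∃ p > 0, Function.Periodic f p) :
    ∃ L > 0, ∀ a b, ‖desired f a - desired f b‖ ≤ L * |a - b| := by
  obtain ⟨p, hp0, hp⟩ := hper
  obtain ⟨M, hM, hfM⟩ := exists_bound_of_periodic hf hp0 hp
  obtain ⟨d0, d1, -⟩ := differentiable_deriv_of_contDiff hf
  refine ⟨M + M, by positivity, fun a b => ?_⟩
  have h0 : ‖f a - f b‖ ≤ M * |a - b| :=
    convex_univ.norm_image_sub_le_of_norm_deriv_le (fun x _ => d0 x) (fun x _ => (hfM x).2.1)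
      (mem_univ b) (mem_univ a)
  have h1 : ‖deriv f a - deriv f b‖ ≤ M * |a - b| :=
    convex_univ.norm_image_sub_le_of_norm_deriv_le (fun x _ => d1 x) (fun x _ => (hfM x).2.2)
      (mem_univ b) (mem_univ a)
  refine abs_le_of_sq_le_sq' ?_ (by positivity) |>.2
  rw [WithLp.prod_norm_sq_eq_of_L2]
  change ‖f a - f b‖ ^ 2 + ‖deriv f a - deriv f b‖ ^ 2 ≤ _
  nlinarith [norm_nonneg (f a - f b), norm_nonneg (deriv f a - deriv f b)]

lemma norm_fst_sub_desired_le_dist (z : OscState n) (τ : ℝ) :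
    ‖z.fst - desired f τ‖ ≤ dist z (desiredState f τ) := by
  rw [dist_eq_norm]
  exact WithLp.norm_fst_le _ (z - desiredState f τ)

lemma abs_snd_sub_le_dist (z : OscState n) (τ : ℝ) : |z.snd - τ| ≤ dist z (desiredState f τ) := by
  rw [dist_eq_norm]
  exact WithLp.norm_snd_le _ (z - desiredState f τ)

lemma dist_desiredState_le (z : OscState n) (τ : ℝ) :
    dist z (desiredState f τ) ≤ ‖z.fst - desired f τ‖ + |z.snd - τ| := by
  rw [dist_eq_norm]
  refine abs_le_of_sq_le_sq' ?_ (by positivity) |>.2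
  rw [WithLp.prod_norm_sq_eq_of_L2]
  change ‖z.fst - desired f τ‖ ^ 2 + |z.snd - τ| ^ 2 ≤ _
  nlinarith [mul_nonneg (norm_nonneg (z.fst - desired f τ)) (abs_nonneg (z.snd - τ))]

/-- Replacing the reference phase `τ` by the state's own phase costs at most `L` times the phase
difference. -/
lemma norm_sub_desired_le_mul_dist {L : ℝ} (hL : ∀ a b, ‖desired f a - desired f b‖ ≤ L * |a - b|)
    (hL0 : 0 < L) (z : OscState n) (τ : ℝ) :
    ‖z.fst - desired f z.snd‖ ≤ (1 + L) * dist z (desiredState f τ) := by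
  have h1 := norm_sub_le_norm_sub_add_norm_sub z.fst (desired f τ) (desired f z.snd)
  have h2 := hL τ z.snd
  rw [abs_sub_comm] at h2
  have h3 := mul_le_mul_of_nonneg_left (abs_snd_sub_le_dist (f := f) z τ) hL0.le
  linarith [norm_fst_sub_desired_le_dist (f := f) z τ]

lemma snd_eq_of_isOscSolution_zero (hz : IsOscSolution f B K 0 z) {t : ℝ} (ht : 0 ≤ t) :
    (z t).snd = t + (z 0).snd := by
  have h : ∀ r ∈ Icc 0 t, HasDerivWithinAt (fun r => (z r).snd) 1 (Icc 0 t) r := fun r hr => by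
    simpa [oscPhaseVel] using (hz.mono (I := Icc 0 t) Icc_subset_Ici_self r hr).2.2
  have h1 := image_sub_le_of_hasDerivWithinAt_le (C := 1) ht h (fun _ _ => le_rfl)
  have h2 := image_sub_le_of_hasDerivWithinAt_le (C := -1) ht (fun r hr => (h r hr).neg)
    (fun _ _ => le_rfl)
  simp only [Pi.neg_apply] at h2
  linarith

lemma isStableTrajectory_desiredState (hf : ContDiff ℝ 3 f)
    (hper : ∃ p > 0, Function.Periodic f p) (hB : B.PosDef) (hK : K.PosDef) (φ₀ : ℝ) :
    IsStableTrajectory {z | IsOscSolution f B K 0 z} (fun t => desiredState f (t + φ₀)) := by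
  obtain ⟨L, hL0, hL⟩ := exists_desired_lipschitz hf hper
  obtain ⟨C, hC, hCz⟩ := exists_norm_sub_desired_le hf hB hK
  intro ε hε t₀ ht₀
  -- Error `C(1 + L)D`, displacement `LD` along the curve and phase difference `D` add up to `(C +
  -- 1)(1 + L)D`.
  refine ⟨ε / ((C + 1) * (1 + L)), by positivity, fun z hz hd t ht => ?_⟩
  rw [lt_div_iff₀ (by positivity)] at hd
  set D := dist (z t₀) (desiredState f (t₀ + φ₀)) with hD
  have h1 := norm_sub_desired_le_mul_dist hL hL0 (z t₀) (t₀ + φ₀)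
  have h2 := hCz 0 le_rfl z hz t₀ ht₀ t ht
  have h3 : |(z t).snd - (t + φ₀)| ≤ D := by
    refine le_trans (le_of_eq ?_) (abs_snd_sub_le_dist (f := f) (z t₀) (t₀ + φ₀))
    rw [snd_eq_of_isOscSolution_zero hz ht₀, snd_eq_of_isOscSolution_zero hz (ht₀.trans ht)]
    ring_nf
  have h4 := norm_sub_le_norm_sub_add_norm_sub (z t).fst (desired f (z t).snd) (desired f (t + φ₀))
  have h5 := hL (z t).snd (t + φ₀)
  have h6 := mul_le_mul_of_nonneg_left h3 hL0.le
  have h7 := mul_le_mul_of_nonneg_left h1 hC.le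
  have h8 := dist_desiredState_le (f := f) (z t) (t + φ₀)
  calc dist (z t) (desiredState f (t + φ₀)) ≤ D * ((C + 1) * (1 + L)) := by linarith
    _ < ε := hd

lemma IsStableTrajectory.mono {X : Type*} [PseudoMetricSpace X] {S S' : Set (ℝ → X)} {r : ℝ → X}
    (h : IsStableTrajectory S r) (hS : S' ⊆ S) : IsStableTrajectory S' r := fun ε hε t₀ ht₀ =>
  let ⟨δ, hδ, hd⟩ := h ε hε t₀ ht₀
  ⟨δ, hδ, fun z hz => hd z (hS hz)⟩

lemma isGloballyAS_desiredState (hf : ContDiff ℝ 3 f) (hper : ∃ p > 0, Function.Periodic f p)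
    (hB : B.PosDef) (hK : K.PosDef) (φ₀ : ℝ) :
    IsGloballyAS {z | IsOscSolution f B K 0 z ∧ (z 0).snd = φ₀}
      (fun t => desiredState f (t + φ₀)) := by
  refine ⟨(isStableTrajectory_desiredState hf hper hB hK φ₀).mono fun z hz => hz.1, ?_⟩
  rintro z ⟨hz, hz0⟩
  refine squeeze_zero' (Eventually.of_forall fun t => dist_nonneg) ?_
    (tendsto_zero_iff_norm_tendsto_zero.1 (tendsto_sub_desired hf hper hB hK le_rfl hz))
  filter_upwards [eventually_ge_atTop 0] with t ht
  have h := dist_desiredState_le (f := f) (z t) (t + φ₀)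
  have e : t + φ₀ = (z t).snd := by rw [snd_eq_of_isOscSolution_zero hz ht, hz0]
  rw [e] at h ⊢
  simpa using h

lemma infDist_desiredState_le (z : OscState n) :
    Metric.infDist z (range (desiredState f)) ≤ ‖z.fst - desired f z.snd‖ := by
  refine (Metric.infDist_le_dist_of_mem (mem_range_self z.snd)).trans ?_
  simpa using dist_desiredState_le (f := f) z z.snd

lemma infDist_desired_le (z : OscState n) :
    Metric.infDist z.fst (range (desired f)) ≤ ‖z.fst - desired f z.snd‖ := by
  rw [← dist_eq_norm]
  exact Metric.infDist_le_dist_of_mem (mem_range_self z.snd)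

/-- The orbit contains the target point at the solution's own phase, so the distance to the orbit is
at most the error, however the phase drifts. -/
lemma isGloballyAOS_desiredState (hf : ContDiff ℝ 3 f) (hper : ∃ p > 0, Function.Periodic f p)
    (hB : B.PosDef) (hK : K.PosDef) :
    IsGloballyAOS {z | ∃ γ ≥ (0 : ℝ), IsOscSolution f B K γ z} (range (desiredState f)) := by
  obtain ⟨L, hL0, hL⟩ := exists_desired_lipschitz hf hper
  obtain ⟨C, hC, hCz⟩ := exists_norm_sub_desired_le hf hB hK
  constructor
  · intro ε hε t₀ ht₀
    refine ⟨ε / (C * (1 + L)), by positivity, ?_⟩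
    rintro z ⟨γ, hγ, hz⟩ hd t ht
    obtain ⟨_, ⟨τ, rfl⟩, hτ⟩ := (Metric.infDist_lt_iff (range_nonempty _)).1 hd
    rw [lt_div_iff₀ (by positivity)] at hτ
    have h1 := norm_sub_desired_le_mul_dist hL hL0 (z t₀) τ
    have h2 := hCz γ hγ z hz t₀ ht₀ t ht
    have h3 := mul_le_mul_of_nonneg_left h1 hC.le
    have h4 := infDist_desiredState_le (f := f) (z t)
    linarith
  · rintro z ⟨γ, hγ, hz⟩
    exact squeeze_zero (fun t => Metric.infDist_nonneg) (fun t => infDist_desiredState_le (z t))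
      (tendsto_zero_iff_norm_tendsto_zero.1 (tendsto_sub_desired hf hper hB hK hγ hz))

lemma tendsto_infDist_desired (hf : ContDiff ℝ 3 f) (hper : ∃ p > 0, Function.Periodic f p)
    (hB : B.PosDef) (hK : K.PosDef) (hγ : 0 ≤ γ) (hz : IsOscSolution f B K γ z) :
    Tendsto (fun t => Metric.infDist (z t).fst (range (desired f))) atTop (𝓝 0) :=
  squeeze_zero (fun _ => Metric.infDist_nonneg) (fun t => infDist_desired_le (z t))
    (tendsto_zero_iff_norm_tendsto_zero.1 (tendsto_sub_desired hf hper hB hK hγ hz))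

end Stability

/-! ### Orbital stability in shape space for large `γ`. -/

section ShapeStability

variable {n : ℕ} {f : ℝ → Joint n} {B K : Matrix (Fin n) (Fin n) ℝ} {γ : ℝ} {z : ℝ → OscState n}

lemma exists_mem_uIcc_deriv_eq_zero {h h' : ℝ → ℝ} {a b : ℝ} (hne : a ≠ b)
    (hd : ∀ x, HasDerivAt h (h' x) x) (hab : h a = h b) : ∃ c ∈ uIcc a b, h' c = 0 := by
  have hc : Continuous h := continuous_iff_continuousAt.2 fun x => (hd x).continuousAt
  rcases hne.lt_or_gt with hlt | hlt
  · obtain ⟨c, hc, h0⟩ := exists_hasDerivAt_eq_zero hlt hc.continuousOn hab fun x _ => hd x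
    exact ⟨c, by rw [uIcc_of_le hlt.le]; exact Ioo_subset_Icc_self hc, h0⟩
  · obtain ⟨c, hc, h0⟩ := exists_hasDerivAt_eq_zero hlt hc.continuousOn hab.symm fun x _ => hd x
    exact ⟨c, by rw [uIcc_of_ge hlt.le]; exact Ioo_subset_Icc_self hc, h0⟩

lemma desired_periodic {p : ℝ} (hp : Function.Periodic f p) :
    Function.Periodic (desired f) p := fun τ => by
  rw [desired, desired, hp τ, hp.deriv_periodic τ]

lemma coupling_toLp_sub_zsmul {p : ℝ} (hp : Function.Periodic f p) (x : Shape n) (φ : ℝ) (j : ℤ) :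
    coupling f K (WithLp.toLp 2 (x, φ - j • p)) = coupling f K (WithLp.toLp 2 (x, φ)) := by
  change inner ℝ (x.fst - f (φ - j • p)) (act K (deriv f (φ - j • p)))
    + inner ℝ (x.snd - deriv f (φ - j • p)) (deriv (deriv f) (φ - j • p)) = _
  rw [hp.sub_zsmul_eq, hp.deriv_periodic.sub_zsmul_eq,
    hp.deriv_periodic.deriv_periodic.sub_zsmul_eq]
  rfl

lemma lyap_toLp_sub_zsmul {p : ℝ} (hp : Function.Periodic f p) (x : Shape n) (φ : ℝ) (j : ℤ) :
    lyap f K (WithLp.toLp 2 (x, φ - j • p)) = lyap f K (WithLp.toLp 2 (x, φ)) := by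
  change (inner ℝ (x.fst - f (φ - j • p)) (act K (x.fst - f (φ - j • p)))
    + inner ℝ (x.snd - deriv f (φ - j • p)) (x.snd - deriv f (φ - j • p))) / 2 = _
  rw [hp.sub_zsmul_eq, hp.deriv_periodic.sub_zsmul_eq]
  rfl

lemma continuous_desired (hf : ContDiff ℝ 3 f) : Continuous (desired f) :=
  (WithLp.prod_continuous_toLp 2 _ _).comp
    (hf.continuous.prodMk (contDiff_deriv hf).continuous)

/-- Near the diagonal of a regular closed curve, the coupling term does not vanish. -/
lemma exists_nhds_coupling_ne_zero (hf : ContDiff ℝ 3 f) (hK : K.PosDef) {τ : ℝ}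
    (hreg : ¬ (deriv f τ = 0 ∧ deriv (deriv f) τ = 0)) :
    ∃ η > 0, ∀ σ ∈ Metric.ball τ η, ∀ φ ∈ Metric.ball τ η,
      coupling f K (WithLp.toLp 2 (desired f σ, φ)) = 0 → σ = φ := by
  obtain ⟨d0, d1, d2⟩ := differentiable_deriv_of_contDiff hf
  -- `H (ξ, φ)` is the `ξ`-derivative of the coupling at shape `q_d(ξ)` and phase `φ`. Regularity
  -- makes it positive on the diagonal point, hence nearby.
  let H : ℝ × ℝ → ℝ := fun x => inner ℝ (deriv f x.1) (act K (deriv f x.2))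
    + inner ℝ (deriv (deriv f) x.1) (deriv (deriv f) x.2)
  have hH : Continuous H :=
    ((d1.continuous.comp continuous_fst).inner
      ((contDiff_act K (m := 1)).continuous.comp (d1.continuous.comp continuous_snd))).add
    ((d2.continuous.comp continuous_fst).inner (d2.continuous.comp continuous_snd))
  have hpos : 0 < H (τ, τ) := by
    obtain ⟨k, hk, hkK⟩ := exists_coercive hK
    have h1 : k * ‖deriv f τ‖ ^ 2 ≤ inner ℝ (deriv f τ) (act K (deriv f τ)) := hkK _
    change 0 < inner ℝ (deriv f τ) (act K (deriv f τ))
      + inner ℝ (deriv (deriv f) τ) (deriv (deriv f) τ)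
    rw [real_inner_self_eq_norm_sq]
    by_cases h0 : deriv f τ = 0
    · have h2 : 0 < ‖deriv (deriv f) τ‖ := norm_pos_iff.2 fun h => hreg ⟨h0, h⟩
      have : 0 ≤ k * ‖deriv f τ‖ ^ 2 := by positivity
      nlinarith
    · have h2 : 0 < ‖deriv f τ‖ := norm_pos_iff.2 h0
      have : 0 < k * ‖deriv f τ‖ ^ 2 := by positivity
      nlinarith [sq_nonneg ‖deriv (deriv f) τ‖]
  obtain ⟨η, hη, hball⟩ := Metric.mem_nhds_iff.1 (hH.continuousAt.preimage_mem_nhds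
    (Ioi_mem_nhds hpos))
  refine ⟨η, hη, fun σ hσ φ hφ hg => ?_⟩
  by_contra hne
  -- The coupling vanishes at `ξ = φ` trivially and at `ξ = σ` by assumption, so Rolle would give a
  -- zero of `H`.
  obtain ⟨ξ, hξ, hξ0⟩ := exists_mem_uIcc_deriv_eq_zero (h := fun ξ =>
    inner ℝ (f ξ - f φ) (act K (deriv f φ)) + inner ℝ (deriv f ξ - deriv f φ) (deriv (deriv f) φ))
    (h' := fun ξ => H (ξ, φ)) hne (fun ξ => by
      have h1 := ((d0 ξ).hasDerivAt.sub_const (f φ)).inner ℝ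
        (hasDerivAt_const ξ (act K (deriv f φ)))
      have h2 := ((d1 ξ).hasDerivAt.sub_const (deriv f φ)).inner ℝ
        (hasDerivAt_const ξ (deriv (deriv f) φ))
      refine (h1.add h2).congr_deriv ?_
      simp [H]) (by
      simp only [sub_self, inner_zero_left, add_zero]
      exact hg)
  have hξ' : ξ ∈ Metric.ball τ η := (convex_ball τ η).ordConnected.uIcc_subset hσ hφ hξ
  have : (ξ, φ) ∈ Metric.ball (τ, τ) η := by
    rw [← ball_prod_same]
    exact ⟨hξ', hφ⟩
  exact (hball this).ne' hξ0

/-- On a simple regular closed curve, a point of the curve close to `q_d(φ)` at which the coupling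
term with phase `φ` vanishes is `q_d(φ)`. -/
lemma exists_radius_coupling_ne_zero (hf : ContDiff ℝ 3 f)
    (hper : ∃ p > 0, Function.Periodic f p) (hK : K.PosDef)
    (hreg : ∀ τ, ¬ (deriv f τ = 0 ∧ deriv (deriv f) τ = 0))
    (hsimple : ∀ a b, desired f a = desired f b → Function.Periodic f (b - a)) :
    ∃ ρ > 0, ∀ σ φ, ‖desired f σ - desired f φ‖ ≤ ρ →
      coupling f K (WithLp.toLp 2 (desired f σ, φ)) = 0 → desired f σ = desired f φ := by
  obtain ⟨p, hp0, hp⟩ := hper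
  have hloc : ∃ ρ > 0, ∀ x ∈ Icc (0 : ℝ) p ×ˢ Icc (0 : ℝ) p,
      ‖desired f x.1 - desired f x.2‖ ≤ ρ →
      coupling f K (WithLp.toLp 2 (desired f x.1, x.2)) = 0 → desired f x.1 = desired f x.2 := by
    refine (isCompact_Icc.prod isCompact_Icc).induction_on
      (p := fun s => ∃ ρ > 0, ∀ x ∈ s, ‖desired f x.1 - desired f x.2‖ ≤ ρ →
        coupling f K (WithLp.toLp 2 (desired f x.1, x.2)) = 0 → desired f x.1 = desired f x.2)
      ⟨1, one_pos, by simp⟩ ?_ ?_ ?_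
    · rintro s t hst ⟨ρ, hρ, h⟩
      exact ⟨ρ, hρ, fun x hx => h x (hst hx)⟩
    · rintro s t ⟨ρ, hρ, h⟩ ⟨ρ', hρ', h'⟩
      refine ⟨min ρ ρ', lt_min hρ hρ', ?_⟩
      rintro x (hx | hx) hle
      · exact h x hx (hle.trans (min_le_left _ _))
      · exact h' x hx (hle.trans (min_le_right _ _))
    · rintro ⟨σ₀, φ₀⟩ -
      -- If the two points coincide, `φ₀ - σ₀` is a period and shifting by it reduces to the
      -- diagonal case. Otherwise the points stay apart nearby, and a small enough radius makes the
      -- claim vacuous.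
      by_cases heq : desired f σ₀ = desired f φ₀
      · have hT := hsimple _ _ heq
        obtain ⟨η, hη, h⟩ := exists_nhds_coupling_ne_zero hf hK (hreg φ₀)
        refine ⟨_, mem_nhdsWithin_of_mem_nhds (prod_mem_nhds (Metric.ball_mem_nhds σ₀ hη)
          (Metric.ball_mem_nhds φ₀ hη)), 1, one_pos, ?_⟩
        rintro ⟨σ, φ⟩ ⟨hσ, hφ⟩ - hg
        have hσT : desired f (σ + (φ₀ - σ₀)) = desired f σ := desired_periodic hT σ
        simp only at hg ⊢
        rw [← hσT] at hg ⊢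
        rw [h (σ + (φ₀ - σ₀)) ?_ φ hφ hg]
        rw [Metric.mem_ball, Real.dist_eq] at hσ ⊢
        convert hσ using 2
        ring
      · have hc : Continuous fun x : ℝ × ℝ => ‖desired f x.1 - desired f x.2‖ :=
          (((continuous_desired hf).comp continuous_fst).sub
            ((continuous_desired hf).comp continuous_snd)).norm
        have hpos : 0 < ‖desired f σ₀ - desired f φ₀‖ := norm_pos_iff.2 (sub_ne_zero.2 heq)
        refine ⟨_, mem_nhdsWithin_of_mem_nhds (hc.continuousAt.preimage_mem_nhds
          (Ioi_mem_nhds (half_lt_self hpos))), _, half_pos hpos, ?_⟩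
        intro x hx hle
        exact absurd hle (not_le.2 hx)
  obtain ⟨ρ, hρ, h⟩ := hloc
  refine ⟨ρ, hρ, fun σ φ hle hg => ?_⟩
  obtain ⟨i, hi, -⟩ := existsUnique_sub_zsmul_mem_Ico hp0 σ 0
  obtain ⟨j, hj, -⟩ := existsUnique_sub_zsmul_mem_Ico hp0 φ 0
  rw [zero_add] at hi hj
  have e1 : desired f (σ - i • p) = desired f σ := (desired_periodic hp).sub_zsmul_eq i
  have e2 : desired f (φ - j • p) = desired f φ := (desired_periodic hp).sub_zsmul_eq j
  have := h (σ - i • p, φ - j • p) ⟨Ico_subset_Icc_self hi, Ico_subset_Icc_self hj⟩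
  simp only [e1, e2] at this
  exact this hle ((coupling_toLp_sub_zsmul hp _ _ _).trans hg)

/-- Near a simple regular closed curve, the coupling term is bounded away from zero where the
energy of the error is, as long as the error is small. -/
lemma exists_coupling_lower_bound (hf : ContDiff ℝ 3 f)
    (hper : ∃ p > 0, Function.Periodic f p) (hK : K.PosDef)
    {ρ : ℝ} (hρ : ∀ σ φ, ‖desired f σ - desired f φ‖ ≤ ρ →
      coupling f K (WithLp.toLp 2 (desired f σ, φ)) = 0 → desired f σ = desired f φ)
    {ε : ℝ} (hε : 0 < ε) :
    ∃ c > 0, ∀ z : OscState n, ‖z.fst - desired f z.snd‖ ≤ ρ → ε ≤ lyap f K z →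
      Metric.infDist z.fst (range (desired f)) < c → c ≤ |coupling f K z| := by
  obtain ⟨M, hM⟩ := exists_norm_desired_le hf hper
  obtain ⟨a, ha, b, hb, hab⟩ := exists_lyap_bounds hK
  obtain ⟨p, hp0, hp⟩ := hper
  have hcd := continuous_desired hf
  have hfst : Continuous fun z : OscState n => z.fst :=
    (contDiff_withLp_prod_fst (m := 1)).continuous
  have hsnd : Continuous fun z : OscState n => z.snd :=
    (contDiff_withLp_prod_snd (m := 1)).continuous
  have herr : Continuous fun z : OscState n => ‖z.fst - desired f z.snd‖ :=
    (hfst.sub (hcd.comp hsnd)).norm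
  -- Restricting the phase to one period makes this set compact; periodicity recovers all other
  -- phases at the end.
  let S : Set (OscState n) :=
    {z | ‖z.fst - desired f z.snd‖ ≤ ρ ∧ ε ≤ lyap f K z ∧ z.snd ∈ Icc 0 p}
  have hclosed : IsClosed S := (isClosed_le herr continuous_const).inter
    ((isClosed_le continuous_const (contDiff_lyap hf).continuous).inter
      (isClosed_Icc.preimage hsnd))
  have hbdd : Bornology.IsBounded S := by
    rw [isBounded_iff_forall_norm_le]
    refine ⟨(ρ + M) + (ρ + M) + p, fun z hz => (norm_oscState_le z).trans ?_⟩
    have h := norm_add_le (z.fst - desired f z.snd) (desired f z.snd)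
    rw [sub_add_cancel] at h
    have h1 : ‖z.fst‖ ≤ ρ + M := h.trans (add_le_add hz.1 (hM _))
    have h2 : |z.snd| ≤ p := by
      rw [abs_of_nonneg hz.2.2.1]
      exact hz.2.2.2
    linarith [WithLp.norm_fst_le _ z.fst, WithLp.norm_snd_le _ z.fst]
  have hcomp : IsCompact S := Metric.isCompact_of_isClosed_isBounded hclosed hbdd
  have hPclosed : IsClosed (range (desired f)) :=
    ((desired_periodic hp).compact_of_continuous hp0.ne' hcd).isClosed
  let m : OscState n → ℝ := fun z =>
    max (Metric.infDist z.fst (range (desired f))) |coupling f K z|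
  have hm : Continuous m := ((Metric.continuous_infDist_pt _).comp hfst).max
    (contDiff_coupling hf).continuous.abs
  -- A zero of `m` would be a point of the curve with vanishing coupling, hence the target itself,
  -- where the energy is zero and not at least `ε`.
  have hmpos : ∀ z ∈ S, 0 < m z := by
    intro z hz
    by_contra hle
    rw [not_lt, max_le_iff] at hle
    obtain ⟨σ, hσ⟩ : z.fst ∈ range (desired f) :=
      (hPclosed.mem_iff_infDist_zero (range_nonempty _)).2
        (le_antisymm hle.1 Metric.infDist_nonneg)
    have hg : coupling f K z = 0 := abs_nonpos_iff.1 hle.2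
    have hzeq : z = WithLp.toLp 2 (desired f σ, z.snd) := by
      rw [hσ]
      rfl
    rw [hzeq] at hg
    have h1 := hρ σ z.snd (by rw [hσ]; exact hz.1) hg
    have h2 := (hab f z).2
    rw [← hσ, h1, sub_self, norm_zero] at h2
    have := hz.2.1
    norm_num at h2
    linarith
  obtain ⟨c, hc, hcm⟩ : ∃ c > 0, ∀ z ∈ S, c ≤ m z := by
    rcases S.eq_empty_or_nonempty with he | hne
    · exact ⟨1, one_pos, by simp [he]⟩
    · obtain ⟨z, hz, hmin⟩ := hcomp.exists_isMinOn hne hm.continuousOn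
      exact ⟨m z, hmpos z hz, fun w hw => hmin hw⟩
  refine ⟨c, hc, fun z h1 h2 h3 => ?_⟩
  obtain ⟨j, hj, -⟩ := existsUnique_sub_zsmul_mem_Ico hp0 z.snd 0
  rw [zero_add] at hj
  have e : desired f (z.snd - j • p) = desired f z.snd := (desired_periodic hp).sub_zsmul_eq j
  have eg : coupling f K (WithLp.toLp 2 (z.fst, z.snd - j • p)) = coupling f K z :=
    coupling_toLp_sub_zsmul hp _ _ _
  have el : lyap f K (WithLp.toLp 2 (z.fst, z.snd - j • p)) = lyap f K z :=
    lyap_toLp_sub_zsmul hp _ _ _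
  have hmem : WithLp.toLp 2 (z.fst, z.snd - j • p) ∈ S :=
    ⟨by
      change ‖z.fst - desired f (z.snd - j • p)‖ ≤ ρ
      rwa [e], by rwa [el], Ico_subset_Icc_self hj⟩
  have h4 := hcm _ hmem
  simp only [m, eg, le_max_iff] at h4
  exact h4.resolve_left (not_le.2 h3)

/-- The gain `γ` enters only the phase equation, so the shape velocity is bounded by the error
alone, uniformly in `γ`. -/
lemma exists_shape_speed_bound (hf : ContDiff ℝ 3 f) (hper : ∃ p > 0, Function.Periodic f p)
    (B K : Matrix (Fin n) (Fin n) ℝ) (ρ : ℝ) :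
    ∃ S > 0, ∀ γ z, IsOscSolution f B K γ z → ∀ s ≥ (0 : ℝ), ∀ t ≥ s,
      (∀ r ∈ Icc s t, ‖(z r).fst - desired f (z r).snd‖ ≤ ρ) →
      ‖(z t).fst - (z s).fst‖ ≤ S * (t - s) := by
  obtain ⟨p, hp0, hp⟩ := hper
  obtain ⟨M, hM, hfM⟩ := exists_bound_of_periodic hf hp0 hp
  obtain ⟨β, hβ, hβB⟩ := norm_act_le B
  obtain ⟨κ, hκ, hκK⟩ := norm_act_le K
  refine ⟨(|ρ| + M) + (M + β * |ρ| + κ * |ρ|), by positivity, fun γ z hz s hs t hst hle => ?_⟩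
  have hsub : Icc s t ⊆ Ici 0 := fun r hr => hs.le.trans hr.1
  have h := (convex_Icc s t).norm_image_sub_le_of_norm_hasDerivWithin_le (f := fun r => (z r).fst)
    (f' := fun r => (oscField f B K γ (z r)).fst)
    (C := (|ρ| + M) + (M + β * |ρ| + κ * |ρ|))
    (fun r hr => (hasDerivWithinAt_withLp_prod_iff.1
      (isOscSolutionOn_iff.1 (hz.mono hsub) r hr)).1) (fun r hr => ?_)
    (left_mem_Icc.2 hst) (right_mem_Icc.2 hst)
  · rwa [Real.norm_eq_abs, abs_of_nonneg (sub_nonneg.2 hst)] at h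
  · have he := (hle r hr).trans (le_abs_self ρ)
    have h1 : ‖(z r).fst.snd‖ ≤ |ρ| + M := by
      have := norm_add_le (velErr f (z r)) (deriv f (z r).snd)
      rw [velErr, sub_add_cancel] at this
      exact this.trans (add_le_add ((norm_velErr_le f _).trans he) (hfM _).2.1)
    have h2 : ‖oscAccel f B K (z r)‖ ≤ M + β * |ρ| + κ * |ρ| := by
      refine (norm_sub_le _ _).trans (add_le_add ((norm_sub_le _ _).trans (add_le_add ?_ ?_)) ?_)
      · exact (hfM _).2.2
      · exact (hβB _).trans (by gcongr; exact (norm_velErr_le f _).trans he)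
      · exact (hκK _).trans (by gcongr; exact (norm_posErr_le f _).trans he)
    refine abs_le_of_sq_le_sq' ?_ (by positivity) |>.2
    rw [WithLp.prod_norm_sq_eq_of_L2]
    change ‖(z r).fst.snd‖ ^ 2 + ‖oscAccel f B K (z r)‖ ^ 2 ≤ _
    nlinarith [norm_nonneg (z r).fst.snd, norm_nonneg (oscAccel f B K (z r))]

/-- While the energy is at least `ε` it falls at rate at least `γ * c ^ 2`; over `[s, t]` this would
exceed the available `V` and make the energy negative. -/
lemma exists_lyap_lt_of_coupling_lower_bound (hf : ContDiff ℝ 3 f) (hB : B.PosDef)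
    (hK : K.PosDef) (hγ : 0 ≤ γ) (hz : IsOscSolution f B K γ z) {s t c ε V : ℝ} (hs : 0 ≤ s)
    (hst : s ≤ t) (hV : lyap f K (z s) ≤ V) (hlarge : V < γ * c ^ 2 * (t - s)) (hc : 0 ≤ c)
    (hcoup : ∀ r ∈ Icc s t, ε ≤ lyap f K (z r) → c ≤ |coupling f K (z r)|) :
    ∃ r ∈ Icc s t, lyap f K (z r) < ε := by
  obtain ⟨a, ha, b, hb, hab⟩ := exists_lyap_bounds hK
  obtain ⟨k, hk, hkB⟩ := exists_coercive hB
  by_contra! hcon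
  have h := image_sub_le_of_hasDerivWithinAt_le (C := -(γ * c ^ 2)) hst (fun r hr => by
    obtain ⟨h₁, h₂, h₃⟩ := hz.mono (I := Icc s t) (fun r hr => hs.trans hr.1) r hr
    exact hasDerivWithinAt_lyap (θ := 1) hf hK (by simpa using h₁) (by simpa using h₂)
        (by simpa using h₃)) (fun r hr => by
    have h1 : 0 ≤ inner ℝ (velErr f (z r)) (act B (velErr f (z r))) :=
      le_trans (by positivity) (hkB _)
    have h2 : c ^ 2 ≤ coupling f K (z r) ^ 2 := by
      rw [← sq_abs (coupling f K (z r))]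
      exact pow_le_pow_left₀ hc (hcoup r hr (hcon r hr)) 2
    have h3 := mul_le_mul_of_nonneg_left h2 hγ
    linarith)
  have h0 : 0 ≤ lyap f K (z t) := le_trans (by positivity) (hab f (z t)).1
  linarith

theorem orbitallyStable_shape_of_simple_regular (hf : ContDiff ℝ 3 f)
    (hper : ∃ p > 0, Function.Periodic f p) (hB : B.PosDef) (hK : K.PosDef)
    (hreg : ∀ τ, ¬ (deriv f τ = 0 ∧ deriv (deriv f) τ = 0))
    (hsimple : ∀ a b, desired f a = desired f b → Function.Periodic f (b - a)) :
    ∃ ρ > 0, ∀ ε > 0, ∃ δ > 0, ∀ᶠ γ : ℝ in atTop,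
      ∀ z, IsOscSolution f B K γ z → ∀ t₀ ≥ (0 : ℝ),
        dist (z t₀).fst (desired f (z t₀).snd) < ρ →
        Metric.infDist (z t₀).fst (range (desired f)) < δ →
        ∀ t ≥ t₀, Metric.infDist (z t).fst (range (desired f)) < ε := by
  obtain ⟨ρ, hρ0, hρ⟩ := exists_radius_coupling_ne_zero hf hper hK hreg hsimple
  obtain ⟨C, hC, hCz⟩ := exists_norm_sub_desired_le hf hB hK
  obtain ⟨a, ha, b, hb, hab⟩ := exists_lyap_bounds hK
  obtain ⟨S, hS, hSz⟩ := exists_shape_speed_bound hf hper B K ρ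
  -- With initial error below `ρ / C`, the error stays at most `ρ` at all later times.
  refine ⟨ρ / C, by positivity, fun ε hε => ?_⟩
  obtain ⟨c, hc, hcoup⟩ := exists_coupling_lower_bound hf hper hK hρ
    (show 0 < a * ε ^ 2 by positivity)
  set δ := min c ε / 2 with hδ
  have hδ0 : 0 < δ := by positivity
  have hδc : δ + δ ≤ c := by
    rw [hδ, add_halves]
    exact min_le_left _ _
  have hδε : δ + δ ≤ ε := by
    rw [hδ, add_halves]
    exact min_le_right _ _
  -- During a time `h` the shape moves by at most `δ`, so it stays within `2δ` of the curve, where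
  -- the coupling bound holds. The threshold on `γ` lets the energy fall below `a * ε ^ 2` within
  -- this time; afterwards the error alone stays below `ε`.
  set h := δ / S with hh
  have hh0 : 0 < h := by positivity
  refine ⟨δ, hδ0, ?_⟩
  filter_upwards [eventually_gt_atTop (b * (ρ / C) ^ 2 / (c ^ 2 * h)), eventually_ge_atTop 0]
    with γ hγl hγ z hz t₀ ht₀ hd hinf t ht
  rw [dist_eq_norm] at hd
  have herr : ∀ r ≥ t₀, ‖(z r).fst - desired f (z r).snd‖ ≤ ρ := fun r hr => by
    refine (hCz γ hγ z hz t₀ ht₀ r hr).trans ?_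
    rw [mul_comm, ← le_div_iff₀ hC]
    exact hd.le
  have hnear : ∀ r ∈ Icc t₀ (t₀ + h),
      Metric.infDist (z r).fst (range (desired f)) < δ + δ := fun r hr => by
    have h1 := hSz γ z hz t₀ ht₀ r hr.1 fun u hu => herr u hu.1
    have h2 : S * (r - t₀) ≤ δ := by
      rw [mul_comm, ← le_div_iff₀ hS]
      linarith [hr.2]
    have h3 := Metric.infDist_le_infDist_add_dist (x := (z r).fst) (y := (z t₀).fst)
      (s := range (desired f))
    rw [dist_eq_norm] at h3
    linarith
  obtain ⟨r, hr, hlt⟩ := exists_lyap_lt_of_coupling_lower_bound (V := b * (ρ / C) ^ 2)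
    (ε := a * ε ^ 2) (t := t₀ + h) (c := c) hf hB hK hγ hz ht₀ (by linarith)
    ((hab f (z t₀)).2.trans (by gcongr))
    (by
      rw [div_lt_iff₀ (by positivity)] at hγl
      rw [add_sub_cancel_left, mul_assoc]
      exact hγl) hc.le
    (fun r hr hl => hcoup (z r) (herr r hr.1) hl ((hnear r hr).trans_le hδc))
  rcases le_total t (t₀ + h) with hle | hge
  · exact (hnear t ⟨ht, hle⟩).trans_le hδε
  · have h1 : lyap f K (z t) ≤ lyap f K (z r) := lyap_antitoneOn hf hB hK hγ hz
      (le_trans ht₀ hr.1) (le_trans ht₀ ht) (hr.2.trans hge)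
    refine (infDist_desired_le (z t)).trans_lt (abs_lt_of_sq_lt_sq' ?_ hε.le).2
    exact lt_of_mul_lt_mul_left (((hab f (z t)).1.trans h1).trans_lt hlt) ha.le

/-- The curve is one point, so the distance to it is the error for every phase, and the uniform
error bound suffices. -/
theorem orbitallyStable_shape_of_const (hf : ContDiff ℝ 3 f) (hB : B.PosDef) (hK : K.PosDef)
    (hconst : ∀ τ, desired f τ = desired f 0) :
    ∃ ρ > 0, ∀ ε > 0, ∃ δ > 0, ∀ᶠ γ : ℝ in atTop,
      ∀ z, IsOscSolution f B K γ z → ∀ t₀ ≥ (0 : ℝ),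
        dist (z t₀).fst (desired f (z t₀).snd) < ρ →
        Metric.infDist (z t₀).fst (range (desired f)) < δ →
        ∀ t ≥ t₀, Metric.infDist (z t).fst (range (desired f)) < ε := by
  obtain ⟨C, hC, hCz⟩ := exists_norm_sub_desired_le hf hB hK
  refine ⟨1, one_pos, fun ε hε => ⟨ε / C, by positivity, ?_⟩⟩
  filter_upwards [eventually_ge_atTop 0] with γ hγ z hz t₀ ht₀ _ hinf t ht
  obtain ⟨_, ⟨τ, rfl⟩, hτ⟩ := (Metric.infDist_lt_iff (range_nonempty _)).1 hinf
  rw [hconst τ, ← hconst (z t₀).snd, dist_eq_norm, lt_div_iff₀ hC, mul_comm] at hτ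
  exact (infDist_desired_le (z t)).trans_lt ((hCz γ hγ z hz t₀ ht₀ t ht).trans_lt hτ)

end ShapeStability

theorem theorem1 {n : ℕ} (f : ℝ → Joint n) (hf : ContDiff ℝ 3 f)
    (hper : ∃ p > 0, Function.Periodic f p)
    (B K : Matrix (Fin n) (Fin n) ℝ) (hB : B.PosDef) (hK : K.PosDef) :
    -- every initial value problem has exactly one forward solution, and it is global
    (∀ γ ≥ (0 : ℝ), ∀ z₀ : OscState n, ∃ z, IsOscSolution f B K γ z ∧ z 0 = z₀ ∧
      ∀ T > 0, ∀ w, IsOscSolutionOn f B K γ (Ico 0 T) w → w 0 = z₀ → EqOn w z (Ico 0 T)) ∧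
    -- (1) the shape state is bounded and converges to the instantaneous target point
    (∀ γ ≥ (0 : ℝ), ∀ z, IsOscSolution f B K γ z →
      Bornology.IsBounded ((fun t => (z t).fst) '' Ici 0) ∧
      Tendsto (fun t => (z t).fst - desired f (z t).snd) atTop (𝓝 0)) ∧
    -- (2) for `γ = 0`: global asymptotic stability of `(q_d(t + φ(0)), t + φ(0))`
    (∀ φ₀ : ℝ,
      IsOscSolution f B K 0 (fun t => desiredState f (t + φ₀)) ∧
      IsGloballyAS {z | IsOscSolution f B K 0 z ∧ (z 0).snd = φ₀}
        (fun t => desiredState f (t + φ₀)) ∧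
      IsStableTrajectory {z | IsOscSolution f B K 0 z} (fun t => desiredState f (t + φ₀))) ∧
    -- (3) the limit cycle: in state space, uniformly in `γ`
    (∀ γ ≥ (0 : ℝ), ∀ φ₀ : ℝ, IsOscSolution f B K γ (fun t => desiredState f (t + φ₀))) ∧
    IsGloballyAOS {z | ∃ γ ≥ (0 : ℝ), IsOscSolution f B K γ z} (range (desiredState f)) ∧
    -- (3) the limit cycle: global attraction in shape space
    (∀ γ ≥ (0 : ℝ), ∀ z, IsOscSolution f B K γ z →
      Tendsto (fun t => Metric.infDist (z t).fst (range (desired f))) atTop (𝓝 0)) ∧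
    -- (3) the limit cycle: orbital stability in shape space as `γ → ∞`
    (IsPointOrSimpleRegular f → ∃ ρ > 0, ∀ ε > 0, ∃ δ > 0, ∀ᶠ γ : ℝ in atTop,
      ∀ z, IsOscSolution f B K γ z → ∀ t₀ ≥ (0 : ℝ),
        dist (z t₀).fst (desired f (z t₀).snd) < ρ →
        Metric.infDist (z t₀).fst (range (desired f)) < δ →
        ∀ t ≥ t₀, Metric.infDist (z t).fst (range (desired f)) < ε) :=
  ⟨fun _ hγ z₀ => exists_unique_oscSolution hf hper hB hK hγ z₀,
    fun _ hγ _ hz => ⟨isBounded_shape hf hper hB hK hγ hz, tendsto_sub_desired hf hper hB hK hγ hz⟩,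
    fun φ₀ => ⟨isOscSolution_desiredState hf 0 φ₀, isGloballyAS_desiredState hf hper hB hK φ₀,
      isStableTrajectory_desiredState hf hper hB hK φ₀⟩,
    fun γ _ φ₀ => isOscSolution_desiredState hf γ φ₀,
    isGloballyAOS_desiredState hf hper hB hK,
    fun _ hγ _ hz => tendsto_infDist_desired hf hper hB hK hγ hz,
    fun h => h.elim (orbitallyStable_shape_of_const hf hB hK)
      fun h => orbitallyStable_shape_of_simple_regular hf hper hB hK h.1 h.2⟩
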